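/- **Model.** A monopolist sells goods $\{1,\dots,n\}$; a bundle is a set $b\in\mathcal B:=2^{\{1,\dots,n\}}$, and $\overline b:=\{1,\dots,n\}$. Types are drawn from $T=[\underline t,\overline t]$, $\underline t<\overline t$, with continuous density $f>0$ on $T$. Type $t$ values bundle $b$ at $v(b,t)$, where $v(\emptyset,t)=0$, and $v$ is nondecreasing in $b$ (set inclusion), continuously differentiable in $t$, and strictly increasing in $t$ whenever positive. Bundle $b$ costs $C(b)\in\mathbb R$ to produce, $C(\emptyset)=0$, and $\overline b$ is the unique maximizer of $v(b,\overline t)-C(b)$ over $b\in\mathcal B$. For $a\in\Delta(\mathcal B)$ let $v(a,t)$ and $C(a)$ be the expectations of $v(b,t)$ and $C(b)$ under $b\sim a$. Let $F_b$ be the distribution function of $v(b,t)$, $P(b,q):=F_b^{-1}(1-q)$ the demand curve (with $F_b^{-1}(0)$ the lowest value), and $\pi(b,q):=(P(b,q)-C(b))\,q$ for $q\in[0,1]$. Throughout, strict quasi-concavity of $g$ on $[x_1,x_2]$ includes the requirement that $g'(x)=0$, $x\in[x_1,x_2]$ (one-sided derivatives at the end points), only if $x$ maximizes $g$ over $[x_1,x_2]$.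 For every $b\ne\emptyset$, $\pi(b,\cdot)$ is strictly quasi-concave on $[0,1]$; its unique maximizer is the (stand-alone) sales volume $D^*(b)$, and $D^*(b)\in(0,1)$ whenever $|b|>1$. For all non-empty $b_1\subsetneq b_2$, $v(b_2,t)-v(b_1,t)$ is strictly increasing in $t$ whenever it is positive, and $\pi(b_2,q)-\pi(b_1,q)$ is strictly quasi-concave in $q\in[0,\min(D^*(b_1),D^*(b_2))]$. A mechanism is a measurable map $(a,p):T\to\Delta(\mathcal B)\times\mathbb R$ such that $v(a(t),t)-p(t)\ge v(a(\hat t),t)-p(\hat t)$ and $v(a(t),t)-p(t)\ge 0$ for all $t,\hat t\in T$. It is optimal if it maximizes the expected profit $\int_T (p(t)-C(a(t)))f(t)\,dt$ among all mechanisms. A menu is a set of bundles containing $\emptyset$; it is nested if it is totally ordered by inclusion. Selling a menu $B$ is optimal if there is an optimal mechanism with $a(t)$ a (deterministic) bundle in $B$ for every $t$. A menu $B$ is minimally optimal if selling $B$ is optimal and selling any menu $B'\subsetneq B$ is not. **Theorem.** Let $B$ be a nested menu. Selling $B$ is optimal if - (i) for all non-empty $b_1\in B$ and all $b_2\in B$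 with $b_1\subsetneq b_2$, $D^*(b_1)>D^*(b_2)$; and - (ii) for all $b_1\notin B$ there is $b_2\in B$ with $b_1\subsetneq b_2$ and $D^*(b_1)\le D^*(b_2)$. Conversely, $B$ is minimally optimal only if - (i) for all non-empty $b_1\in B$ and all $b_2\in B$ with $b_1\subsetneq b_2$, $D^*(b_1)>D^*(b_2)$; and - (ii$'$) for all $b_1\notin B$ there is a non-empty $b_2\in B$ with $D^*(b_1)\le D^*(b_2)$. -/

import Mathlib

open Set MeasureTheory

noncomputable section

/-- A bundle of the goods `1, …, n`. -/
abbrev Bundle (n : ℕ) : Type := Finset (Fin n)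

/-- `g` is strictly quasi-concave on `[x₁, x₂]`, and moreover its first-order condition (with
one-sided derivatives at the end points) can hold only at a maximum point over `[x₁, x₂]`. -/
def StrictlyQuasiconcaveFOC (g : ℝ → ℝ) (x₁ x₂ : ℝ) : Prop :=
  (∀ x ∈ Icc x₁ x₂, ∀ y ∈ Icc x₁ x₂, ∀ z, x < z → z < y → min (g x) (g y) < g z) ∧
  (∀ x ∈ Icc x₁ x₂, HasDerivWithinAt g 0 (Icc x₁ x₂) x → IsMaxOn g (Icc x₁ x₂) x)

/-- The primitives of the screening problem: the type interval `[tLo, tHi]`, the density `f` of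
the type distribution, the values `v b t` and the production costs `C b`.  Only the values of `f`
and `v b` on `[tLo, tHi]` matter. -/
structure BundlingModel (n : ℕ) where
  tLo : ℝ
  tHi : ℝ
  f : ℝ → ℝ
  v : Bundle n → ℝ → ℝ
  C : Bundle n → ℝ

namespace BundlingModel

variable {n : ℕ} (M : BundlingModel n)

/-- The type space. -/
def T : Set ℝ := Icc M.tLo M.tHi

/-- The value of a stochastic assignment (a probability vector on the bundles). -/
def value (α : Bundle n → ℝ) (t : ℝ) : ℝ := ∑ b, α b * M.v b t

/-- The expected production cost of a stochastic assignment. -/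
def cost (α : Bundle n → ℝ) : ℝ := ∑ b, α b * M.C b

/-- The distribution function `F_b` of the value `v(b, t)` of the bundle `b`. -/
def valueCDF (b : Bundle n) (x : ℝ) : ℝ := ∫ t in {t | t ∈ M.T ∧ M.v b t ≤ x}, M.f t

/-- The demand curve `P(b, q) = F_b⁻¹(1 - q)`: the smallest attained value `x` of the bundle with
`F_b(x) ≥ 1 - q` (so that `F_b⁻¹(0)` is the lowest value and `F_b⁻¹(1)` the highest). -/
def demand (b : Bundle n) (q : ℝ) : ℝ := sInf {x | x ∈ M.v b '' M.T ∧ 1 - q ≤ M.valueCDF b x}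

/-- The profit function `π(b, q) = (P(b, q) - C(b)) q` of the bundle `b` sold alone. -/
def profitFn (b : Bundle n) (q : ℝ) : ℝ := (M.demand b q - M.C b) * q

/-- The sales volume `D*(b)`: the maximizer of `π(b, ·)` over `[0, 1]`.  It exists and is unique
for every non-empty bundle under the assumptions below; for the empty bundle, whose profit
function is zero, it has no meaning and is never used. -/
def salesVolume (b : Bundle n) : ℝ :=
  Classical.epsilon fun q => q ∈ Icc (0 : ℝ) 1 ∧ IsMaxOn (M.profitFn b) (Icc 0 1) q

/-- The assumptions of the model. -/
structure Assumptions : Prop where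
  tLo_lt_tHi : M.tLo < M.tHi
  f_continuous : ContinuousOn M.f M.T
  f_pos : ∀ t ∈ M.T, 0 < M.f t
  f_integral : ∫ t in M.T, M.f t = 1
  v_empty : ∀ t ∈ M.T, M.v ∅ t = 0
  v_mono : ∀ b₁ b₂ : Bundle n, b₁ ⊆ b₂ → ∀ t ∈ M.T, M.v b₁ t ≤ M.v b₂ t
  v_contDiff : ∀ b, ContDiffOn ℝ 1 (M.v b) M.T
  v_strictMono : ∀ b, ∀ t ∈ M.T, ∀ t' ∈ M.T, t < t' → 0 < M.v b t → M.v b t < M.v b t'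
  C_empty : M.C ∅ = 0
  /-- It is uniquely efficient for the highest type to consume all the items. -/
  efficient_top : ∀ b : Bundle n, b ≠ Finset.univ →
    M.v b M.tHi - M.C b < M.v Finset.univ M.tHi - M.C Finset.univ
  profitFn_quasiconcave : ∀ b : Bundle n, b.Nonempty →
    StrictlyQuasiconcaveFOC (M.profitFn b) 0 1
  salesVolume_interior : ∀ b : Bundle n, 1 < b.card → M.salesVolume b ∈ Ioo (0 : ℝ) 1
  /-- Incremental values are strictly increasing whenever positive. -/
  increment_strictMono : ∀ b₁ b₂ : Bundle n, b₁ ⊂ b₂ → ∀ t ∈ M.T, ∀ t' ∈ M.T, t < t' →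
    0 < M.v b₂ t - M.v b₁ t → M.v b₂ t - M.v b₁ t < M.v b₂ t' - M.v b₁ t'
  /-- Incremental profits are locally strictly quasi-concave.  (For `b₁ = ∅` this would follow
  from `profitFn_quasiconcave`.) -/
  increment_quasiconcave : ∀ b₁ b₂ : Bundle n, b₁.Nonempty → b₁ ⊂ b₂ →
    StrictlyQuasiconcaveFOC (fun q => M.profitFn b₂ q - M.profitFn b₁ q) 0
      (min (M.salesVolume b₁) (M.salesVolume b₂))

/-- A stochastic direct mechanism: a measurable map from types to stochastic assignments and
payments, incentive compatible and individually rational. -/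
structure IsMechanism (a : ℝ → Bundle n → ℝ) (p : ℝ → ℝ) : Prop where
  assignment : ∀ t ∈ M.T, a t ∈ stdSimplex ℝ (Bundle n)
  measurable_a : Measurable fun t : M.T => a t
  measurable_p : Measurable fun t : M.T => p t
  IC : ∀ t ∈ M.T, ∀ t' ∈ M.T, M.value (a t') t - p t' ≤ M.value (a t) t - p t
  IR : ∀ t ∈ M.T, 0 ≤ M.value (a t) t - p t

/-- The expected profit of a mechanism. -/
def expectedProfit (a : ℝ → Bundle n → ℝ) (p : ℝ → ℝ) : ℝ :=
  ∫ t in M.T, (p t - M.cost (a t)) * M.f t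

/-- Optimality among all stochastic mechanisms. -/
def IsOptimalMechanism (a : ℝ → Bundle n → ℝ) (p : ℝ → ℝ) : Prop :=
  M.IsMechanism a p ∧
    ∀ a' p', M.IsMechanism a' p' → M.expectedProfit a' p' ≤ M.expectedProfit a p

/-- Selling the menu `B` is optimal: some optimal mechanism assigns to every type, with
certainty, a bundle in `B`. -/
def SellingOptimal (B : Set (Bundle n)) : Prop :=
  ∃ a p, M.IsOptimalMechanism a p ∧ ∀ t ∈ M.T, ∃ b ∈ B, a t = Pi.single b 1

end BundlingModel

/-- A menu: a set of bundles that includes the empty bundle. -/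
def IsMenu {n : ℕ} (B : Set (Bundle n)) : Prop := ∅ ∈ B

/-- A menu is nested if its bundles are ordered by set inclusion. -/
def IsNested {n : ℕ} (B : Set (Bundle n)) : Prop := ∀ b₁ ∈ B, ∀ b₂ ∈ B, b₁ ⊆ b₂ ∨ b₂ ⊆ b₁

/-- Selling the menu `B` is optimal and selling any strictly smaller menu is not. -/
def BundlingModel.MinimallyOptimal {n : ℕ} (M : BundlingModel n) (B : Set (Bundle n)) : Prop :=
  M.SellingOptimal B ∧ ∀ B' : Set (Bundle n), IsMenu B' → B' ⊂ B → ¬ M.SellingOptimal B'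

end

/-! Everything is expressed by the virtual profit ψ_b(t) = (v(b,t) − C(b)) f(t) − (1 − F(t))
∂v(b,t)/∂t, with F the distribution function of the type. Its negative is the derivative of the
profit from selling b to all types above t, and this profit is π(b, ·) at the quantity 1 − F(t).
Since F has a Lipschitz inverse, quasi-concavity in quantities becomes single crossing in types: ψ_b
crosses zero once, from below, at the threshold type θ_b with 1 − F(θ_b) = D*(b), and for nested b₁
⊂ b₂ the difference ψ_{b₂} − ψ_{b₁} crosses zero at most once, from below, above both thresholds. A
larger sales volume is a lower threshold.

By the envelope formula (`expectedProfit_eq`) every mechanism earns at most the integral of its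
expected virtual profit, and every increasing deterministic assignment attains this bound
(`isMechanism_of_monotoneOn`).

Sufficiency: let each type receive the bundle of B with the largest ψ. Condition (i) and single
crossing make this assignment increasing, hence implementable. Condition (ii) makes every bundle
outside B no better, type by type, than a larger bundle of B or nothing, so the assignment maximizes
ψ over all bundles and lotteries.

Converse: an optimal nested menu has an optimal increasing assignment
(`exists_monotoneOn_of_sellingOptimal`), and minimality makes every non-empty bundle be sold on an
interval of types. Moving the type at which a bundle c takes over from its predecessor d yields ψ_c
= ψ_d there. By induction along the chain, thresholds strictly increase, which is (i). For (ii'),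
suppose that b has a lower threshold than the smallest non-empty bundle c on offer. Selling b with a
small probability to the types between the two thresholds then raises profit
(`exists_lottery_improvement`). -/

noncomputable section

open Filter Topology

/-! ### Calculus: quasi-concavity, change of variable, strict integral inequalities -/

theorem HasDerivWithinAt.eventually_lt_of_pos {g : ℝ → ℝ} {d t : ℝ} {S : Set ℝ}
    (hg : HasDerivWithinAt g d S t) (hd : 0 < d) :
    ∀ᶠ w in 𝓝[S \ {t}] t, (w < t → g w < g t) ∧ (t < w → g t < g w) := by
  rw [hasDerivWithinAt_iff_tendsto_slope] at hg
  filter_upwards [hg.eventually (lt_mem_nhds hd)] with w hw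
  rw [slope_def_field] at hw
  constructor
  · intro h
    by_contra! h'
    exact absurd hw (not_lt.2 (div_nonpos_of_nonneg_of_nonpos (by linarith) (by linarith)))
  · intro h
    by_contra! h'
    exact absurd hw (not_lt.2 (div_nonpos_of_nonpos_of_nonneg (by linarith) (by linarith)))

theorem HasDerivWithinAt.exists_lt_left {g : ℝ → ℝ} {d a b z t : ℝ}
    (hg : HasDerivWithinAt g d (Icc a b) t) (hd : 0 < d) (haz : a ≤ z) (hzt : z < t)
    (htb : t ≤ b) : ∃ w ∈ Ioo z t, g w < g t := by
  have h1 : HasDerivWithinAt g d (Ioo z t) t :=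
    hg.mono fun x hx => ⟨haz.trans hx.1.le, hx.2.le.trans htb⟩
  have h2 := h1.eventually_lt_of_pos hd
  rw [sdiff_singleton_eq_self (by simp), nhdsWithin_Ioo_eq_nhdsLT hzt] at h2
  obtain ⟨w, hw, hw'⟩ := (h2.and (Ioo_mem_nhdsLT hzt)).exists
  exact ⟨w, hw', hw.1 hw'.2⟩

theorem HasDerivWithinAt.exists_lt_right {g : ℝ → ℝ} {d a b z t : ℝ}
    (hg : HasDerivWithinAt g d (Icc a b) t) (hd : d < 0) (hat : a ≤ t) (htz : t < z)
    (hzb : z ≤ b) : ∃ w ∈ Ioo t z, g w < g t := by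
  have h1 : HasDerivWithinAt (fun x => -g x) (-d) (Ioo t z) t :=
    (hg.mono fun x hx => ⟨hat.trans hx.1.le, hx.2.le.trans hzb⟩).neg
  have h2 := h1.eventually_lt_of_pos (neg_pos.2 hd)
  rw [sdiff_singleton_eq_self (by simp), nhdsWithin_Ioo_eq_nhdsGT htz] at h2
  obtain ⟨w, hw, hw'⟩ := (h2.and (Ioo_mem_nhdsGT htz)).exists
  exact ⟨w, hw', neg_lt_neg_iff.1 (hw.2 hw'.1)⟩

/-- The derivative of a strictly quasi-concave function satisfying the first-order condition
crosses zero at most once, from above. -/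
theorem StrictlyQuasiconcaveFOC.deriv_pos_of_lt {g g' : ℝ → ℝ} {a b : ℝ}
    (hg : StrictlyQuasiconcaveFOC g a b)
    (hd : ∀ x ∈ Icc a b, HasDerivWithinAt g (g' x) (Icc a b) x)
    {s t : ℝ} (hs : a ≤ s) (hst : s < t) (ht : t ≤ b) (h0 : 0 ≤ g' t) : 0 < g' s := by
  have hsm : s ∈ Icc a b := ⟨hs, hst.le.trans ht⟩
  have htm : t ∈ Icc a b := ⟨hs.trans hst.le, ht⟩
  have max_of_zero : ∀ x ∈ Icc a b, g' x = 0 → IsMaxOn g (Icc a b) x := fun x hx h =>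
    hg.2 x hx (h ▸ hd x hx)
  by_contra! hneg
  -- A point `w` below `g t` forces `g s < g w`, which is incompatible with a nonpositive slope at
  -- `s`. Otherwise `t` is a maximizer, and a second critical point `s` would be a second maximizer.
  obtain ⟨w, hw, hgw⟩ | ht0 : (∃ w ∈ Ioo s t, g w < g t) ∨ g' t = 0 := by
    rcases h0.lt_or_eq with h | h
    · exact Or.inl ((hd t htm).exists_lt_left h hs hst ht)
    · exact Or.inr h.symm
  · have hwm : w ∈ Icc a b := ⟨hs.trans hw.1.le, hw.2.le.trans ht⟩
    have hsw : g s < g w := by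
      rcases min_lt_iff.1 (hg.1 s hsm t htm w hw.1 hw.2) with h | h
      · exact h
      · exact absurd h hgw.not_gt
    rcases hneg.lt_or_eq with h | h
    · obtain ⟨z, hz, hgz⟩ := (hd s hsm).exists_lt_right h hs hw.1 hwm.2
      rcases min_lt_iff.1 (hg.1 s hsm w hwm z hz.1 hz.2) with h | h <;> linarith
    · exact absurd (max_of_zero s hsm h hwm) (not_le.2 hsw)
  · have htmax := max_of_zero t htm ht0
    rcases hneg.lt_or_eq with h | h
    · obtain ⟨z, hz, hgz⟩ := (hd s hsm).exists_lt_right h hs hst ht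
      have hzm : z ∈ Icc a b := ⟨hs.trans hz.1.le, hz.2.le.trans ht⟩
      have : g z ≤ g t := htmax hzm
      rcases min_lt_iff.1 (hg.1 s hsm t htm z hz.1 hz.2) with h | h <;> linarith
    · have hmid : (s + t) / 2 ∈ Icc a b := ⟨by linarith, by linarith⟩
      have h1 : g ((s + t) / 2) ≤ g t := htmax hmid
      have h2 : g ((s + t) / 2) ≤ g s := max_of_zero s hsm h hmid
      rcases min_lt_iff.1 (hg.1 s hsm t htm ((s + t) / 2) (by linarith) (by linarith))
        with h | h <;> linarith

/-- Increments of `H` control those of its argument up to the factor `K`, so an increment of `G`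
that is little-o in the argument is little-o in `H`. No differentiability of `g` is presupposed. -/
theorem hasDerivWithinAt_zero_of_comp {g G H : ℝ → ℝ} {a b c K t : ℝ}
    (hsurj : SurjOn H (Icc a b) (Icc 0 c)) (hG : ∀ t ∈ Icc a b, G t = g (H t))
    (hK : ∀ s ∈ Icc a b, ∀ t ∈ Icc a b, |s - t| ≤ K * |H s - H t|) (ht : t ∈ Icc a b)
    (hd : HasDerivWithinAt G 0 (Icc a b) t) : HasDerivWithinAt g 0 (Icc 0 c) (H t) := by
  rw [hasDerivWithinAt_iff_isLittleO] at hd ⊢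
  simp only [smul_zero, sub_zero] at hd ⊢
  rw [Asymptotics.isLittleO_iff] at hd ⊢
  have hK' : ∀ s ∈ Icc a b, ∀ t ∈ Icc a b, |s - t| ≤ (|K| + 1) * |H s - H t| :=
    fun s hs t ht => (hK s hs t ht).trans (by
      gcongr
      linarith [le_abs_self K])
  intro ε hε
  have hε' : 0 < ε / (|K| + 1) := by positivity
  have h := hd hε'
  rw [eventually_nhdsWithin_iff, Metric.eventually_nhds_iff] at h
  obtain ⟨δ, hδ, h⟩ := h
  rw [eventually_nhdsWithin_iff, Metric.eventually_nhds_iff]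
  refine ⟨δ / (|K| + 1), by positivity, ?_⟩
  intro q hq hqm
  obtain ⟨s, hs, rfl⟩ := hsurj hqm
  rw [Real.dist_eq, lt_div_iff₀ (by positivity)] at hq
  have h1 := hK' s hs t ht
  have h2 := h (y := s) (by rw [Real.dist_eq]; linarith) hs
  rw [hG s hs, hG t ht] at h2
  refine h2.trans ?_
  rw [Real.norm_eq_abs, Real.norm_eq_abs, div_mul_eq_mul_div, div_le_iff₀ (by positivity)]
  nlinarith

/-- Strict quasi-concavity is invariant under decreasing changes of variables with Lipschitz
inverse. -/
theorem StrictlyQuasiconcaveFOC.comp_strictAntiOn {g G H : ℝ → ℝ} {a b c K : ℝ}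
    (hg : StrictlyQuasiconcaveFOC g 0 c) (hmaps : MapsTo H (Icc a b) (Icc 0 c))
    (hsurj : SurjOn H (Icc a b) (Icc 0 c)) (hanti : StrictAntiOn H (Icc a b))
    (hK : ∀ s ∈ Icc a b, ∀ t ∈ Icc a b, |s - t| ≤ K * |H s - H t|)
    (hG : ∀ t ∈ Icc a b, G t = g (H t)) : StrictlyQuasiconcaveFOC G a b := by
  refine ⟨fun x hx y hy z hxz hzy => ?_, fun t ht hd => ?_⟩
  · have hz : z ∈ Icc a b := ⟨hx.1.trans hxz.le, hzy.le.trans hy.2⟩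
    rw [hG x hx, hG y hy, hG z hz, min_comm]
    exact hg.1 _ (hmaps hy) _ (hmaps hx) _ (hanti hz hy hzy) (hanti hx hz hxz)
  · intro s hs
    change G s ≤ G t
    rw [hG s hs, hG t ht]
    exact hg.2 _ (hmaps ht) (hasDerivWithinAt_zero_of_comp hsurj hG hK ht hd) (hmaps hs)

/-- The exceptional point `z` absorbs the single type at which a variation of an assignment is not
controlled. -/
theorem setIntegral_Icc_lt_of_lt_Ioo {a b u w z : ℝ} {g h : ℝ → ℝ}
    (hg : IntegrableOn g (Icc a b)) (hh : IntegrableOn h (Icc a b))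
    (hle : ∀ t ∈ Icc a b, t ≠ z → g t ≤ h t) (huw : u < w) (hau : a ≤ u) (hwb : w ≤ b)
    (hlt : ∀ t ∈ Ioo u w, g t < h t) :
    ∫ t in Icc a b, g t < ∫ t in Icc a b, h t := by
  rw [← sub_pos, ← integral_sub hh hg, 
    setIntegral_pos_iff_support_of_nonneg_ae (f := fun t => h t - g t) _ (hh.sub hg)]
  · refine lt_of_lt_of_le (by simpa using huw : 0 < volume (Ioo u w)) (measure_mono ?_)
    intro t ht
    refine ⟨?_, hau.trans ht.1.le, ht.2.le.trans hwb⟩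
    simpa [sub_eq_zero] using (hlt t ht).ne'
  · rw [EventuallyLE, ae_restrict_iff' measurableSet_Icc]
    have : ∀ᵐ t : ℝ, t ≠ z := by
      simp [ae_iff]
    filter_upwards [this] with t ht htm
    simpa using hle t htm ht

/-! ### Demand, thresholds and single crossing of virtual profits -/

namespace BundlingModel

variable {n : ℕ} (M : BundlingModel n)

/-- The distribution function of the type. -/
def cdf (t : ℝ) : ℝ := ∫ s in M.tLo..t, M.f s

/-- The marginal value of the type. -/
def dv (b : Bundle n) (t : ℝ) : ℝ := derivWithin (M.v b) M.T t

/-- The virtual profit of the bundle `b` at the type `t`, weighted with the density. -/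
def virtualProfit (b : Bundle n) (t : ℝ) : ℝ :=
  (M.v b t - M.C b) * M.f t - (1 - M.cdf t) * M.dv b t

/-- The profit from selling the bundle `b` to the types above `t`. -/
def tailProfit (b : Bundle n) (t : ℝ) : ℝ := (M.v b t - M.C b) * (1 - M.cdf t)

/-- The lowest type who buys the bundle `b` when it is sold alone at its optimal price. -/
def threshold (b : Bundle n) : ℝ :=
  Classical.epsilon fun θ => θ ∈ M.T ∧ 1 - M.cdf θ = M.salesVolume b

variable {M}

theorem cdf_tLo (M : BundlingModel n) : M.cdf M.tLo = 0 := intervalIntegral.integral_same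

namespace Assumptions

variable (hM : M.Assumptions)
include hM

theorem tLo_mem : M.tLo ∈ M.T := left_mem_Icc.2 hM.tLo_lt_tHi.le

theorem tHi_mem : M.tHi ∈ M.T := right_mem_Icc.2 hM.tLo_lt_tHi.le

theorem uniqueDiffOn : UniqueDiffOn ℝ M.T := uniqueDiffOn_Icc hM.tLo_lt_tHi

theorem intervalIntegrable_f {s t : ℝ} (hs : s ∈ M.T) (ht : t ∈ M.T) :
    IntervalIntegrable M.f volume s t :=
  (hM.f_continuous.mono (ordConnected_Icc.uIcc_subset hs ht)).intervalIntegrable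

theorem cdf_tHi : M.cdf M.tHi = 1 := by
  rw [cdf, intervalIntegral.integral_of_le hM.tLo_lt_tHi.le, ← integral_Icc_eq_integral_Ioc]
  exact hM.f_integral

theorem cdf_sub {s t : ℝ} (hs : s ∈ M.T) (ht : t ∈ M.T) :
    M.cdf t - M.cdf s = ∫ r in s..t, M.f r :=
  intervalIntegral.integral_interval_sub_left (hM.intervalIntegrable_f hM.tLo_mem ht)
    (hM.intervalIntegrable_f hM.tLo_mem hs)

theorem hasDerivWithinAt_cdf {t : ℝ} (ht : t ∈ M.T) :
    HasDerivWithinAt M.cdf (M.f t) M.T t := by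
  have : Fact (t ∈ Icc M.tLo M.tHi) := ⟨ht⟩
  change HasDerivWithinAt M.cdf (M.f t) (Icc M.tLo M.tHi) t
  exact intervalIntegral.integral_hasDerivWithinAt_right
    (hM.intervalIntegrable_f hM.tLo_mem ht)
    (hM.f_continuous.stronglyMeasurableAtFilter_nhdsWithin measurableSet_Icc t)
    (hM.f_continuous t ht)

theorem continuousOn_cdf : ContinuousOn M.cdf M.T := fun _ ht =>
  (hM.hasDerivWithinAt_cdf ht).continuousWithinAt

/-- The continuous positive density has a positive minimum on the compact type space; this makes the
inverse of the distribution function Lipschitz. -/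
theorem exists_mul_le_cdf_sub :
    ∃ m > 0, ∀ s ∈ M.T, ∀ t ∈ M.T, s ≤ t → m * (t - s) ≤ M.cdf t - M.cdf s := by
  obtain ⟨x, hx, hmin⟩ := isCompact_Icc.exists_isMinOn ⟨_, hM.tLo_mem⟩ hM.f_continuous
  refine ⟨M.f x, hM.f_pos x hx, fun s hs t ht hst => ?_⟩
  rw [hM.cdf_sub hs ht]
  have := intervalIntegral.integral_mono_on (μ := volume) hst
    (intervalIntegrable_const (c := M.f x)) (hM.intervalIntegrable_f hs ht)
    fun r hr => hmin (show r ∈ M.T from ⟨hs.1.trans hr.1, hr.2.trans ht.2⟩)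
  simpa [mul_comm] using this

theorem strictMonoOn_cdf : StrictMonoOn M.cdf M.T := by
  obtain ⟨m, hm, h⟩ := hM.exists_mul_le_cdf_sub
  intro s hs t ht hst
  have := h s hs t ht hst.le
  have : 0 < m * (t - s) := mul_pos hm (sub_pos.2 hst)
  linarith

theorem cdf_mem {t : ℝ} (ht : t ∈ M.T) : M.cdf t ∈ Icc (0 : ℝ) 1 := by
  constructor
  · rw [← M.cdf_tLo]
    exact hM.strictMonoOn_cdf.monotoneOn hM.tLo_mem ht ht.1
  · rw [← hM.cdf_tHi]
    exact hM.strictMonoOn_cdf.monotoneOn ht hM.tHi_mem ht.2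

theorem exists_cdf_eq {q : ℝ} (hq : q ∈ Icc (0 : ℝ) 1) : ∃ t ∈ M.T, 1 - M.cdf t = q := by
  have h := intermediate_value_Icc hM.tLo_lt_tHi.le hM.continuousOn_cdf
  rw [M.cdf_tLo, hM.cdf_tHi] at h
  obtain ⟨t, ht, h'⟩ := h (show 1 - q ∈ Icc (0 : ℝ) 1 from ⟨by linarith [hq.2], by linarith [hq.1]⟩)
  exact ⟨t, ht, by linarith⟩

theorem v_nonneg (b : Bundle n) {t : ℝ} (ht : t ∈ M.T) : 0 ≤ M.v b t := by
  rw [← hM.v_empty t ht]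
  exact hM.v_mono _ _ (Finset.empty_subset b) t ht

theorem monotoneOn_increment {b₁ b₂ : Bundle n} (hb : b₁ ⊆ b₂) :
    MonotoneOn (fun t => M.v b₂ t - M.v b₁ t) M.T := by
  intro s hs t ht hst
  rcases hb.eq_or_ssubset with rfl | hb'
  · simp
  rcases hst.eq_or_lt with rfl | hst
  · rfl
  by_cases h : 0 < M.v b₂ s - M.v b₁ s
  · exact (hM.increment_strictMono b₁ b₂ hb' s hs t ht hst h).le
  · have := hM.v_mono b₁ b₂ hb t ht
    simp only
    linarith

theorem monotoneOn_v (b : Bundle n) : MonotoneOn (M.v b) M.T := by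
  intro s hs t ht hst
  have := hM.monotoneOn_increment (Finset.empty_subset b) hs ht hst
  simpa [hM.v_empty s hs, hM.v_empty t ht] using this

theorem continuousOn_v (b : Bundle n) : ContinuousOn (M.v b) M.T :=
  (hM.v_contDiff b).continuousOn

theorem hasDerivWithinAt_v (b : Bundle n) {t : ℝ} (ht : t ∈ M.T) :
    HasDerivWithinAt (M.v b) (M.dv b t) M.T t :=
  (((hM.v_contDiff b).differentiableOn (by simp)) t ht).hasDerivWithinAt

theorem continuousOn_dv (b : Bundle n) : ContinuousOn (M.dv b) M.T :=
  (hM.v_contDiff b).continuousOn_derivWithin hM.uniqueDiffOn le_rfl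

theorem dv_mono {b₁ b₂ : Bundle n} (hb : b₁ ⊆ b₂) {t : ℝ} (ht : t ∈ M.T) :
    M.dv b₁ t ≤ M.dv b₂ t := by
  have h := ((hM.hasDerivWithinAt_v b₂ ht).sub (hM.hasDerivWithinAt_v b₁ ht)).derivWithin
    (hM.uniqueDiffOn t ht)
  have h' := (hM.monotoneOn_increment hb).derivWithin_nonneg (x := t)
  rw [← sub_nonneg, ← h]
  exact h'

theorem dv_empty {t : ℝ} (ht : t ∈ M.T) : M.dv ∅ t = 0 := by
  have : HasDerivWithinAt (M.v ∅) 0 M.T t :=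
    (hasDerivWithinAt_const t M.T 0).congr hM.v_empty (hM.v_empty t ht)
  exact this.derivWithin (hM.uniqueDiffOn t ht)

theorem dv_nonneg (b : Bundle n) {t : ℝ} (ht : t ∈ M.T) : 0 ≤ M.dv b t :=
  hM.dv_empty ht ▸ hM.dv_mono (Finset.empty_subset b) ht

theorem integral_dv (b : Bundle n) {s t : ℝ} (hs : s ∈ M.T) (ht : t ∈ M.T) (hst : s ≤ t) :
    ∫ r in s..t, M.dv b r = M.v b t - M.v b s := by
  have hsub : Icc s t ⊆ M.T := Icc_subset_Icc hs.1 ht.2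
  refine intervalIntegral.integral_eq_sub_of_hasDerivAt_of_le hst
    ((hM.continuousOn_v b).mono hsub) (fun r hr => ?_)
    (((hM.continuousOn_dv b).mono (by rwa [uIcc_of_le hst])).intervalIntegrable)
  exact (hM.hasDerivWithinAt_v b (hsub ⟨hr.1.le, hr.2.le⟩)).hasDerivAt
    (Icc_mem_nhds (hs.1.trans_lt hr.1) (hr.2.trans_le ht.2))

theorem virtualProfit_empty {t : ℝ} (ht : t ∈ M.T) : M.virtualProfit ∅ t = 0 := by
  simp [virtualProfit, hM.v_empty t ht, hM.C_empty, hM.dv_empty ht]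

theorem continuousOn_virtualProfit (b : Bundle n) : ContinuousOn (M.virtualProfit b) M.T :=
  (((hM.continuousOn_v b).sub continuousOn_const).mul hM.f_continuous).sub
    ((continuousOn_const.sub hM.continuousOn_cdf).mul (hM.continuousOn_dv b))

theorem hasDerivWithinAt_tailProfit (b : Bundle n) {t : ℝ} (ht : t ∈ M.T) :
    HasDerivWithinAt (M.tailProfit b) (-M.virtualProfit b t) M.T t := by
  have := ((hM.hasDerivWithinAt_v b ht).sub_const (M.C b)).mul
    ((hM.hasDerivWithinAt_cdf ht).const_sub 1)
  refine HasDerivWithinAt.congr_deriv this ?_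
  simp only [virtualProfit]
  ring

theorem continuousOn_tailProfit (b : Bundle n) : ContinuousOn (M.tailProfit b) M.T :=
  fun _ ht => (hM.hasDerivWithinAt_tailProfit b ht).continuousWithinAt

theorem cdf_le_valueCDF (b : Bundle n) {t : ℝ} (ht : t ∈ M.T) :
    M.cdf t ≤ M.valueCDF b (M.v b t) := by
  have hmeas : MeasurableSet {s | s ∈ M.T ∧ M.v b s ≤ M.v b t} :=
    ((hM.continuousOn_v b).preimage_isClosed_of_isClosed isClosed_Icc
      isClosed_Iic).measurableSet
  have hsub : {s | s ∈ M.T ∧ M.v b s ≤ M.v b t} ⊆ M.T := fun s hs => hs.1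
  rw [cdf, intervalIntegral.integral_of_le ht.1, ← integral_Icc_eq_integral_Ioc, valueCDF]
  refine setIntegral_mono_set ((hM.f_continuous.integrableOn_Icc).mono_set hsub) ?_ ?_
  · exact (ae_restrict_iff' hmeas).2 (.of_forall fun s hs => (hM.f_pos s hs.1).le)
  · refine LE.le.eventuallyLE fun s hs => ?_
    have hsT : s ∈ M.T := ⟨hs.1, hs.2.trans ht.2⟩
    exact ⟨hsT, hM.monotoneOn_v b hsT ht hs.2⟩

theorem valueCDF_lt_cdf (b : Bundle n) {s t : ℝ} (hs : s ∈ M.T) (ht : t ∈ M.T)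
    (h : M.v b s < M.v b t) : M.valueCDF b (M.v b s) < M.cdf t := by
  have hst : s < t := by
    by_contra! hts
    exact absurd (hM.monotoneOn_v b ht hs hts) (not_le.2 h)
  -- A type with an intermediate value separates the sublevel set from `t`, which makes the
  -- inequality strict.
  obtain ⟨r, hr, hvr⟩ := intermediate_value_Icc hst.le
    ((hM.continuousOn_v b).mono (Icc_subset_Icc hs.1 ht.2))
    (show (M.v b s + M.v b t) / 2 ∈ Icc (M.v b s) (M.v b t) from ⟨by linarith, by linarith⟩)
  have hrT : r ∈ M.T := ⟨hs.1.trans hr.1, hr.2.trans ht.2⟩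
  have hrt : r < t := lt_of_le_of_ne hr.2 (by rintro rfl; linarith)
  refine lt_of_le_of_lt ?_ (hM.strictMonoOn_cdf hrT ht hrt)
  rw [cdf, intervalIntegral.integral_of_le hrT.1, ← integral_Icc_eq_integral_Ioc, valueCDF]
  refine setIntegral_mono_set
    ((hM.f_continuous.integrableOn_Icc).mono_set (Icc_subset_Icc le_rfl hrT.2)) ?_ ?_
  · exact (ae_restrict_iff' measurableSet_Icc).2
      (.of_forall fun s hs => (hM.f_pos s ⟨hs.1, hs.2.trans hrT.2⟩).le)
  · refine LE.le.eventuallyLE fun w hw => ⟨hw.1.1, ?_⟩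
    by_contra! hrw
    have := hM.monotoneOn_v b hrT hw.1 hrw.le
    linarith [hw.2]

/-- Values are only weakly increasing in the type (they may be flat at zero), so the two comparisons
of distribution functions replace an inversion. -/
theorem demand_eq (b : Bundle n) {t : ℝ} (ht : t ∈ M.T) :
    M.demand b (1 - M.cdf t) = M.v b t := by
  refine IsLeast.csInf_eq ⟨⟨⟨t, ht, rfl⟩, ?_⟩, ?_⟩
  · simpa using hM.cdf_le_valueCDF b ht
  · rintro _ ⟨⟨s, hs, rfl⟩, h⟩
    by_contra! hlt
    have := hM.valueCDF_lt_cdf b hs ht hlt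
    linarith

theorem profitFn_eq (b : Bundle n) {t : ℝ} (ht : t ∈ M.T) :
    M.profitFn b (1 - M.cdf t) = M.tailProfit b t := by
  rw [profitFn, hM.demand_eq b ht, tailProfit]

theorem salesVolume_spec (b : Bundle n) :
    M.salesVolume b ∈ Icc (0 : ℝ) 1 ∧ IsMaxOn (M.profitFn b) (Icc 0 1) (M.salesVolume b) := by
  refine Classical.epsilon_spec
    (p := fun q => q ∈ Icc (0 : ℝ) 1 ∧ IsMaxOn (M.profitFn b) (Icc 0 1) q) ?_
  obtain ⟨t, ht, hmax⟩ := isCompact_Icc.exists_isMaxOn ⟨_, hM.tLo_mem⟩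
    (hM.continuousOn_tailProfit b)
  have h := hM.cdf_mem ht
  refine ⟨1 - M.cdf t, ⟨by linarith [h.2], by linarith [h.1]⟩, fun q hq => ?_⟩
  obtain ⟨s, hs, rfl⟩ := hM.exists_cdf_eq hq
  change M.profitFn b _ ≤ M.profitFn b _
  rw [hM.profitFn_eq b hs, hM.profitFn_eq b ht]
  exact hmax hs

theorem threshold_spec (b : Bundle n) :
    M.threshold b ∈ M.T ∧ 1 - M.cdf (M.threshold b) = M.salesVolume b :=
  Classical.epsilon_spec (p := fun θ => θ ∈ M.T ∧ 1 - M.cdf θ = M.salesVolume b)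
    (hM.exists_cdf_eq (hM.salesVolume_spec b).1)

theorem threshold_mem (b : Bundle n) : M.threshold b ∈ M.T := (hM.threshold_spec b).1

theorem isMaxOn_tailProfit (b : Bundle n) :
    IsMaxOn (M.tailProfit b) M.T (M.threshold b) := by
  intro t ht
  have h := (hM.salesVolume_spec b).2
  rw [← (hM.threshold_spec b).2] at h
  have hc := hM.cdf_mem ht
  have h' : M.profitFn b (1 - M.cdf t) ≤ M.profitFn b (1 - M.cdf (M.threshold b)) :=
    h ⟨by linarith [hc.2], by linarith [hc.1]⟩
  rwa [hM.profitFn_eq b ht, hM.profitFn_eq b (hM.threshold_mem b)] at h'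

theorem salesVolume_lt_iff (b₁ b₂ : Bundle n) :
    M.salesVolume b₁ < M.salesVolume b₂ ↔ M.threshold b₂ < M.threshold b₁ := by
  rw [← (hM.threshold_spec b₁).2, ← (hM.threshold_spec b₂).2, sub_lt_sub_iff_left,
    hM.strictMonoOn_cdf.lt_iff_lt (hM.threshold_mem b₂) (hM.threshold_mem b₁)]

theorem salesVolume_le_iff (b₁ b₂ : Bundle n) :
    M.salesVolume b₁ ≤ M.salesVolume b₂ ↔ M.threshold b₂ ≤ M.threshold b₁ := by
  rw [← not_lt, hM.salesVolume_lt_iff, not_lt]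

theorem threshold_interior {b : Bundle n} (hb : 1 < b.card) :
    M.threshold b ∈ Ioo M.tLo M.tHi := by
  have h := hM.salesVolume_interior b hb
  rw [← (hM.threshold_spec b).2] at h
  have hm := hM.threshold_mem b
  refine ⟨lt_of_le_of_ne hm.1 fun he => ?_, lt_of_le_of_ne hm.2 fun he => ?_⟩
  · rw [← he, M.cdf_tLo] at h
    simp at h
  · rw [he, hM.cdf_tHi] at h
    simp at h

/-- Profits that are strictly quasi-concave in the quantity are so in the marginal type. -/
theorem strictlyQuasiconcave_type {g G : ℝ → ℝ} {θ : ℝ} (hθ : θ ∈ M.T)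
    (hg : StrictlyQuasiconcaveFOC g 0 (1 - M.cdf θ))
    (hG : ∀ t ∈ M.T, G t = g (1 - M.cdf t)) : StrictlyQuasiconcaveFOC G θ M.tHi := by
  have hsub : Icc θ M.tHi ⊆ M.T := Icc_subset_Icc hθ.1 le_rfl
  obtain ⟨m, hm, hmle⟩ := hM.exists_mul_le_cdf_sub
  refine hg.comp_strictAntiOn (H := fun t => 1 - M.cdf t) (K := m⁻¹) ?_ ?_ ?_ ?_
    fun t ht => hG t (hsub ht)
  · intro t ht
    have h1 := (hM.cdf_mem (hsub ht)).2
    have h2 := hM.strictMonoOn_cdf.monotoneOn hθ (hsub ht) ht.1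
    exact ⟨by linarith, by linarith⟩
  · intro q hq
    obtain ⟨t, ht, rfl⟩ := hM.exists_cdf_eq (q := q)
      ⟨hq.1, hq.2.trans (by linarith [(hM.cdf_mem hθ).1])⟩
    refine ⟨t, ⟨(hM.strictMonoOn_cdf.le_iff_le hθ ht).1 (by linarith [hq.2]), ht.2⟩, rfl⟩
  · intro s hs t ht hst
    have := hM.strictMonoOn_cdf (hsub hs) (hsub ht) hst
    simp only
    linarith
  · have key : ∀ s ∈ Icc θ M.tHi, ∀ t ∈ Icc θ M.tHi, s ≤ t →
        |s - t| ≤ m⁻¹ * |(1 - M.cdf s) - (1 - M.cdf t)| := by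
      intro s hs t ht hst
      have h1 := hmle s (hsub hs) t (hsub ht) hst
      rw [abs_sub_comm, abs_of_nonneg (sub_nonneg.2 hst), inv_mul_eq_div, le_div_iff₀ hm,
        mul_comm]
      exact h1.trans ((le_abs_self _).trans_eq (by congr 1; ring))
    intro s hs t ht
    rcases le_total s t with h | h
    · exact key s hs t ht h
    · rw [abs_sub_comm, abs_sub_comm (1 - M.cdf s)]
      exact key t ht s hs h

theorem singleCrossing_of_quasiconcave {g g' G : ℝ → ℝ} {θ : ℝ} (hθ : θ ∈ M.T)
    (hg : StrictlyQuasiconcaveFOC g 0 (1 - M.cdf θ))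
    (hG : ∀ t ∈ M.T, G t = g (1 - M.cdf t))
    (hG' : ∀ t ∈ M.T, HasDerivWithinAt G (-g' t) M.T t) {s t : ℝ} (hs : θ ≤ s) (hst : s < t)
    (ht : t ≤ M.tHi) (h : 0 ≤ g' s) : 0 < g' t := by
  have hsub : Icc θ M.tHi ⊆ M.T := Icc_subset_Icc hθ.1 le_rfl
  by_contra! h'
  have := (hM.strictlyQuasiconcave_type hθ hg hG).deriv_pos_of_lt (g' := fun t => -g' t)
    (fun x hx => (hG' x (hsub hx)).mono hsub) hs hst ht (by simpa using h')
  linarith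

theorem virtualProfit_singleCrossing {b : Bundle n} (hb : b.Nonempty) {s t : ℝ}
    (hs : s ∈ M.T) (ht : t ∈ M.T) (hst : s < t) (h : 0 ≤ M.virtualProfit b s) :
    0 < M.virtualProfit b t :=
  hM.singleCrossing_of_quasiconcave hM.tLo_mem (g := M.profitFn b)
    (by simpa [M.cdf_tLo] using hM.profitFn_quasiconcave b hb)
    (fun t ht => (hM.profitFn_eq b ht).symm) (fun t ht => hM.hasDerivWithinAt_tailProfit b ht)
    hs.1 hst ht.2 h

theorem increment_singleCrossing {b₁ b₂ : Bundle n} (hb₁ : b₁.Nonempty) (hb : b₁ ⊂ b₂)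
    {s t : ℝ} (h₁ : M.threshold b₁ ≤ s) (h₂ : M.threshold b₂ ≤ s) (ht : t ∈ M.T)
    (hst : s < t) (h : M.virtualProfit b₁ s ≤ M.virtualProfit b₂ s) :
    M.virtualProfit b₁ t < M.virtualProfit b₂ t := by
  have hmem : max (M.threshold b₁) (M.threshold b₂) ∈ M.T := by
    rcases max_choice (M.threshold b₁) (M.threshold b₂) with h | h <;> rw [h]
    exacts [hM.threshold_mem b₁, hM.threshold_mem b₂]
  -- The quantities up to the smaller sales volume are exactly those sold by cutoffs above the
  -- larger threshold.
  have hmin : 1 - M.cdf (max (M.threshold b₁) (M.threshold b₂)) =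
      min (M.salesVolume b₁) (M.salesVolume b₂) := by
    rcases le_total (M.threshold b₁) (M.threshold b₂) with h | h
    · rw [max_eq_right h, min_eq_right ((hM.salesVolume_le_iff _ _).2 h),
        (hM.threshold_spec b₂).2]
    · rw [max_eq_left h, min_eq_left ((hM.salesVolume_le_iff _ _).2 h),
        (hM.threshold_spec b₁).2]
  have := hM.singleCrossing_of_quasiconcave hmem
    (g := fun q => M.profitFn b₂ q - M.profitFn b₁ q)
    (g' := fun t => M.virtualProfit b₂ t - M.virtualProfit b₁ t)
    (G := fun t => M.tailProfit b₂ t - M.tailProfit b₁ t)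
    (by rw [hmin]; exact hM.increment_quasiconcave b₁ b₂ hb₁ hb)
    (fun t ht => by simp only [hM.profitFn_eq _ ht])
    (fun t ht => ((hM.hasDerivWithinAt_tailProfit b₂ ht).sub
      (hM.hasDerivWithinAt_tailProfit b₁ ht)).congr_deriv (by ring))
    (max_le h₁ h₂) hst ht.2 (by linarith)
  linarith

theorem hasDerivAt_tailProfit (b : Bundle n) {t : ℝ} (ht : t ∈ Ioo M.tLo M.tHi) :
    HasDerivAt (M.tailProfit b) (-M.virtualProfit b t) t :=
  (hM.hasDerivWithinAt_tailProfit b (Ioo_subset_Icc_self ht)).hasDerivAt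
    (Icc_mem_nhds ht.1 ht.2)

/-- A nonpositive value at `t` would, by single crossing, be preceded by negative values back to the
threshold; tail profit would then increase beyond its maximizer. -/
theorem virtualProfit_pos {b : Bundle n} (hb : b.Nonempty) {t : ℝ} (ht : t ∈ M.T)
    (h : M.threshold b < t) : 0 < M.virtualProfit b t := by
  by_contra! h'
  have hθ := hM.threshold_mem b
  have hmono : StrictMonoOn (M.tailProfit b) (Icc (M.threshold b) t) := by
    refine strictMonoOn_of_deriv_pos (convex_Icc _ _)
      ((hM.continuousOn_tailProfit b).mono (Icc_subset_Icc hθ.1 ht.2)) fun s hs => ?_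
    rw [interior_Icc] at hs
    rw [(hM.hasDerivAt_tailProfit b ⟨hθ.1.trans_lt hs.1, hs.2.trans_le ht.2⟩).deriv, neg_pos]
    by_contra! h0
    exact absurd (hM.virtualProfit_singleCrossing hb
      ⟨hθ.1.trans hs.1.le, hs.2.le.trans ht.2⟩ ht hs.2 h0) (not_lt.2 h')
  exact absurd (hM.isMaxOn_tailProfit b ht)
    (not_le.2 (hmono (left_mem_Icc.2 h.le) (right_mem_Icc.2 h.le) h))

theorem virtualProfit_neg {b : Bundle n} (hb : b.Nonempty) {t : ℝ} (ht : t ∈ M.T)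
    (h : t < M.threshold b) : M.virtualProfit b t < 0 := by
  by_contra! h'
  have hθ := hM.threshold_mem b
  have hanti : StrictAntiOn (M.tailProfit b) (Icc t (M.threshold b)) := by
    refine strictAntiOn_of_deriv_neg (convex_Icc _ _)
      ((hM.continuousOn_tailProfit b).mono (Icc_subset_Icc ht.1 hθ.2)) fun s hs => ?_
    rw [interior_Icc] at hs
    rw [(hM.hasDerivAt_tailProfit b ⟨ht.1.trans_lt hs.1, hs.2.trans_le hθ.2⟩).deriv, neg_lt_zero]
    exact hM.virtualProfit_singleCrossing hb ht
      ⟨ht.1.trans hs.1.le, hs.2.le.trans hθ.2⟩ hs.1 h'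
  exact absurd (hM.isMaxOn_tailProfit b ht)
    (not_le.2 (hanti (left_mem_Icc.2 h.le) (right_mem_Icc.2 h.le) h))

/-- A strict inequality between virtual profits persists to the right. -/
theorem exists_right_lt {b c : Bundle n} {t u : ℝ} (ht : t ∈ M.T) (hu : t < u)
    (h : M.virtualProfit b t < M.virtualProfit c t) :
    ∃ x, t < x ∧ x < u ∧ ∀ s ∈ M.T, t ≤ s → s ≤ x → M.virtualProfit b s < M.virtualProfit c s := by
  have := (hM.continuousOn_virtualProfit b t ht).eventually_lt
    (hM.continuousOn_virtualProfit c t ht) h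
  rw [eventually_nhdsWithin_iff, Metric.eventually_nhds_iff] at this
  obtain ⟨ε, hε, H⟩ := this
  refine ⟨min (t + ε / 2) ((t + u) / 2), ?_, ?_, fun s hs h1 h2 => H ?_ hs⟩
  · exact lt_min (by linarith) (by linarith)
  · exact (min_le_right _ _).trans_lt (by linarith)
  · rw [Real.dist_eq, abs_of_nonneg (by linarith)]
    have := h2.trans (min_le_left _ _)
    linarith

/-- A strict inequality between virtual profits persists to the left. -/
theorem exists_left_lt {b c : Bundle n} {t u : ℝ} (ht : t ∈ M.T) (hu : u < t)
    (h : M.virtualProfit b t < M.virtualProfit c t) :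
    ∃ x, u < x ∧ x < t ∧ ∀ s ∈ M.T, x ≤ s → s ≤ t → M.virtualProfit b s < M.virtualProfit c s := by
  have := (hM.continuousOn_virtualProfit b t ht).eventually_lt
    (hM.continuousOn_virtualProfit c t ht) h
  rw [eventually_nhdsWithin_iff, Metric.eventually_nhds_iff] at this
  obtain ⟨ε, hε, H⟩ := this
  refine ⟨max (t - ε / 2) ((t + u) / 2), ?_, ?_, fun s hs h1 h2 => H ?_ hs⟩
  · exact lt_of_lt_of_le (by linarith) (le_max_right _ _)
  · exact max_lt (by linarith) (by linarith)
  · rw [Real.dist_eq, abs_sub_comm, abs_of_nonneg (by linarith)]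
    have := (le_max_left _ _).trans h1
    linarith

theorem virtualProfit_threshold_nonneg {b : Bundle n} (hb : b.Nonempty)
    (h : M.threshold b < M.tHi) : 0 ≤ M.virtualProfit b (M.threshold b) := by
  have hθ := hM.threshold_mem b
  by_contra! h'
  rw [← hM.virtualProfit_empty hθ] at h'
  obtain ⟨x, h1, h2, H⟩ := hM.exists_right_lt hθ h h'
  have hx : x ∈ M.T := ⟨hθ.1.trans h1.le, h2.le⟩
  have := H x hx h1.le le_rfl
  rw [hM.virtualProfit_empty hx] at this
  exact absurd (hM.virtualProfit_pos hb hx h1) this.not_gt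

theorem virtualProfit_threshold_nonpos {b : Bundle n} (hb : b.Nonempty)
    (h : M.tLo < M.threshold b) : M.virtualProfit b (M.threshold b) ≤ 0 := by
  have hθ := hM.threshold_mem b
  by_contra! h'
  rw [← hM.virtualProfit_empty hθ] at h'
  obtain ⟨x, h1, h2, H⟩ := hM.exists_left_lt hθ h h'
  have hx : x ∈ M.T := ⟨h1.le, h2.le.trans hθ.2⟩
  have := H x hx le_rfl h2.le
  rw [hM.virtualProfit_empty hx] at this
  exact absurd (hM.virtualProfit_neg hb hx h2) this.not_gt

end Assumptions

/-! ### Rents, the envelope formula and implementability -/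

/-- The information rent under a deterministic assignment. -/
def rent (M : BundlingModel n) (β : ℝ → Bundle n) (t : ℝ) : ℝ :=
  ∫ s in M.tLo..t, M.dv (β s) s

theorem measurableSet_T (M : BundlingModel n) : MeasurableSet M.T := measurableSet_Icc

theorem sum_single_mul (c : Bundle n) (g : Bundle n → ℝ) :
    ∑ b, (Pi.single c 1 : Bundle n → ℝ) b * g b = g c := by
  simp [Pi.single_apply]

theorem value_single (c : Bundle n) (t : ℝ) : M.value (Pi.single c 1) t = M.v c t :=
  sum_single_mul c fun b => M.v b t

/-- The level sets of a monotone map into a partial order are order-connected, hence measurable. -/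
theorem measurable_single_of_monotoneOn {β : ℝ → Bundle n} (hβ : MonotoneOn β M.T) :
    Measurable fun t : M.T => (Pi.single (β t) 1 : Bundle n → ℝ) := by
  refine measurable_pi_iff.2 fun b => ?_
  have hord : OrdConnected {t : M.T | b = β t} := by
    refine ⟨fun s hs t ht r hr => ?_⟩
    have h1 := hβ s.2 r.2 hr.1
    have h2 := hβ r.2 t.2 hr.2
    rw [← (show b = β s from hs)] at h1
    rw [← (show b = β t from ht)] at h2
    exact le_antisymm h1 h2
  simp only [Pi.single_apply]
  exact Measurable.ite hord.measurableSet measurable_const measurable_const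

theorem integrableOn_sum_mul {a : ℝ → Bundle n → ℝ} {g : Bundle n → ℝ → ℝ}
    (ha : ∀ t ∈ M.T, a t ∈ stdSimplex ℝ (Bundle n)) (hmeas : Measurable fun t : M.T => a t)
    (hg : ∀ b, ContinuousOn (g b) M.T) : IntegrableOn (fun t => ∑ b, a t b * g b t) M.T := by
  refine integrable_finsetSum _ fun b _ => ?_
  have hae : AEMeasurable (fun t => a t b) (volume.restrict M.T) :=
    aemeasurable_restrict_of_measurable_subtype measurableSet_Icc
      ((measurable_pi_apply b).comp hmeas)
  refine Integrable.bdd_mul (c := 1) (hg b).integrableOn_Icc hae.aestronglyMeasurable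
    ((ae_restrict_iff' measurableSet_Icc).2 (.of_forall fun t ht => ?_))
  have h := ha t ht
  rw [Real.norm_eq_abs, abs_of_nonneg (h.1 b), ← h.2]
  exact Finset.single_le_sum (fun c _ => h.1 c) (Finset.mem_univ b)

theorem integrableOn_of_monotoneOn {β : ℝ → Bundle n} {g : Bundle n → ℝ → ℝ}
    (hβ : MonotoneOn β M.T) (hg : ∀ b, ContinuousOn (g b) M.T) :
    IntegrableOn (fun t => g (β t) t) M.T := by
  have := integrableOn_sum_mul (M := M) (a := fun t => Pi.single (β t) 1) (g := g)
    (fun t _ => single_mem_stdSimplex ℝ (β t)) (measurable_single_of_monotoneOn hβ) hg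
  simpa only [sum_single_mul _ fun b => g b _] using this

namespace Assumptions

variable (hM : M.Assumptions)
include hM

theorem exists_lipschitz_value :
    ∃ K : NNReal, ∀ α ∈ stdSimplex ℝ (Bundle n), ∀ s ∈ M.T, ∀ t ∈ M.T,
      M.value α s ≤ M.value α t + K * dist s t := by
  choose K hK using fun b => (hM.v_contDiff b).exists_lipschitzOnWith (by simp)
    (convex_Icc _ _) isCompact_Icc
  refine ⟨∑ b, K b, fun α hα s hs t ht => ?_⟩
  have hKb : ∀ b, (K b : ℝ) ≤ ((∑ b, K b : NNReal) : ℝ) := fun b =>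
    NNReal.coe_le_coe.2 (Finset.single_le_sum (fun c _ => zero_le) (Finset.mem_univ b))
  have h : ∀ b, α b * M.v b s ≤ α b * M.v b t + α b * (((∑ b, K b : NNReal) : ℝ) * dist s t) := by
    intro b
    rw [← mul_add]
    refine mul_le_mul_of_nonneg_left ?_ (hα.1 b)
    have h1 := (hK b).dist_le_mul s hs t ht
    rw [Real.dist_eq] at h1
    have h2 := mul_le_mul_of_nonneg_right (hKb b) (dist_nonneg (x := s) (y := t))
    linarith [le_abs_self (M.v b s - M.v b t)]
  calc M.value α s ≤ ∑ b, (α b * M.v b t + α b * (((∑ b, K b : NNReal) : ℝ) * dist s t)) :=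
        Finset.sum_le_sum fun b _ => h b
    _ = _ := by rw [Finset.sum_add_distrib, ← Finset.sum_mul, hα.2, one_mul, value]

theorem hasDerivAt_value (α : Bundle n → ℝ) {t : ℝ} (ht : t ∈ Ioo M.tLo M.tHi) :
    HasDerivAt (M.value α) (∑ b, α b * M.dv b t) t :=
  HasDerivAt.fun_sum fun b _ =>
    ((hM.hasDerivWithinAt_v b (Ioo_subset_Icc_self ht)).hasDerivAt
      (Icc_mem_nhds ht.1 ht.2)).const_mul (α b)

/-- The envelope formula for the expected profit. -/
theorem expectedProfit_eq {a : ℝ → Bundle n → ℝ} {p : ℝ → ℝ} (h : M.IsMechanism a p) :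
    M.expectedProfit a p = (∫ t in M.T, ∑ b, a t b * M.virtualProfit b t) -
      (M.value (a M.tLo) M.tLo - p M.tLo) := by
  set U : ℝ → ℝ := fun t => M.value (a t) t - p t with hU
  have hle := hM.tLo_lt_tHi.le
  obtain ⟨K, hK⟩ := hM.exists_lipschitz_value
  have hUlip : LipschitzOnWith K U (uIcc M.tLo M.tHi) := by
    rw [uIcc_of_le hle]
    refine LipschitzOnWith.of_le_add_mul K fun s hs t ht => ?_
    have h1 := hK (a s) (h.assignment s hs) s hs t ht
    have h2 := h.IC t ht s hs
    simp only [hU]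
    linarith
  have hUac := hUlip.absolutelyContinuousOnInterval
  have hFac : AbsolutelyContinuousOnInterval (fun t => 1 - M.cdf t) M.tLo M.tHi := by
    have hcdf : AbsolutelyContinuousOnInterval M.cdf M.tLo M.tHi :=
      (hM.intervalIntegrable_f hM.tLo_mem
        hM.tHi_mem).absolutelyContinuousOnInterval_intervalIntegral left_mem_uIcc
    have hone : AbsolutelyContinuousOnInterval (fun _ : ℝ => (1 : ℝ)) M.tLo M.tHi :=
      (LipschitzWith.const (1 : ℝ)).lipschitzOnWith.absolutelyContinuousOnInterval
    exact hone.sub hcdf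
  -- Integrating the derivative of the utility times 1 − F, which vanishes at the top type, replaces
  -- Fubini and leaves only the utility of the lowest type.
  have hW := hUac.mul hFac
  have hWint := hW.intervalIntegrable_deriv
  have hWeq := hW.integral_deriv_eq_sub
  rw [intervalIntegrable_iff_integrableOn_Icc_of_le hle] at hWint
  rw [intervalIntegral.integral_of_le hle, ← integral_Icc_eq_integral_Ioc] at hWeq
  set w : ℝ → ℝ := fun t => (∑ b, a t b * M.dv b t) * (1 - M.cdf t) - U t * M.f t with hw
  have hae : deriv (U * fun t => 1 - M.cdf t) =ᵐ[volume.restrict M.T] w := by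
    rw [EventuallyEq, ae_restrict_iff' M.measurableSet_T]
    have hlo : ∀ᵐ t : ℝ, t ≠ M.tLo := by simp [ae_iff]
    have hhi : ∀ᵐ t : ℝ, t ≠ M.tHi := by simp [ae_iff]
    filter_upwards [hUac.ae_differentiableAt, hlo, hhi] with t hdiff hl hh ht
    have htI : t ∈ Ioo M.tLo M.tHi := ⟨lt_of_le_of_ne ht.1 hl.symm, lt_of_le_of_ne ht.2 hh⟩
    have hd := (hdiff (by rwa [uIcc_of_le hle])).hasDerivAt
    -- Truth-telling: the utility of `s` exceeds what `s` gets from reporting `t`, with equality at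
    -- `s = t`.
    have hmin : IsLocalMin (fun s => U s - (M.value (a t) s - p t)) t := by
      filter_upwards [Icc_mem_nhds htI.1 htI.2] with s hs
      have := h.IC s hs t ht
      simp only [hU]
      linarith
    have h0 := hmin.hasDerivAt_eq_zero (hd.sub ((hM.hasDerivAt_value (a t) htI).sub_const (p t)))
    have hF : HasDerivAt M.cdf (M.f t) t :=
      (hM.hasDerivWithinAt_cdf ht).hasDerivAt (Icc_mem_nhds htI.1 htI.2)
    rw [(hd.mul (hF.const_sub 1)).deriv, hw, sub_eq_zero.1 h0]
    simp only
    ring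
  have hwint : IntegrableOn w M.T := hWint.congr hae
  have hweq : ∫ t in M.T, w t = -U M.tLo := by
    rw [← integral_congr_ae hae]
    refine hWeq.trans ?_
    simp [hM.cdf_tHi, M.cdf_tLo]
  have hψ := integrableOn_sum_mul h.assignment h.measurable_a hM.continuousOn_virtualProfit
  calc M.expectedProfit a p
      = ∫ t in M.T, ((∑ b, a t b * M.virtualProfit b t) + w t) := by
        refine integral_congr_ae (.of_forall fun t => ?_)
        have : ∑ b, a t b * M.virtualProfit b t = (M.value (a t) t - M.cost (a t)) * M.f t -
            (1 - M.cdf t) * ∑ b, a t b * M.dv b t := by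
          rw [value, cost, ← Finset.sum_sub_distrib, Finset.sum_mul, Finset.mul_sum,
            ← Finset.sum_sub_distrib]
          refine Finset.sum_congr rfl fun b _ => ?_
          simp only [virtualProfit]
          ring
        simp only [this, hw, hU]
        ring
    _ = _ := by
        rw [integral_add hψ hwint, hweq]
        rfl

theorem expectedProfit_le {a : ℝ → Bundle n → ℝ} {p : ℝ → ℝ} (h : M.IsMechanism a p) :
    M.expectedProfit a p ≤ ∫ t in M.T, ∑ b, a t b * M.virtualProfit b t := by
  rw [hM.expectedProfit_eq h]
  linarith [h.IR M.tLo hM.tLo_mem]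

section Deterministic

variable {β : ℝ → Bundle n} (hβ : MonotoneOn β M.T)
include hβ

theorem intervalIntegrable_dv {s t : ℝ} (hs : s ∈ M.T) (ht : t ∈ M.T) :
    IntervalIntegrable (fun r => M.dv (β r) r) volume s t :=
  ((integrableOn_of_monotoneOn hβ hM.continuousOn_dv).mono_set
    (ordConnected_Icc.uIcc_subset hs ht)).intervalIntegrable

theorem rent_sub {s t : ℝ} (hs : s ∈ M.T) (ht : t ∈ M.T) :
    M.rent β t - M.rent β s = ∫ r in s..t, M.dv (β r) r :=
  intervalIntegral.integral_interval_sub_left (hM.intervalIntegrable_dv hβ hM.tLo_mem ht)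
    (hM.intervalIntegrable_dv hβ hM.tLo_mem hs)

theorem increment_le_rent {c : Bundle n} {s t : ℝ} (hs : s ∈ M.T) (ht : t ∈ M.T) (hst : s ≤ t)
    (hc : ∀ r ∈ Ioo s t, c ⊆ β r) : M.v c t - M.v c s ≤ M.rent β t - M.rent β s := by
  rw [hM.rent_sub hβ hs ht, ← hM.integral_dv c hs ht hst]
  refine intervalIntegral.integral_mono_on_of_le_Ioo hst
    (((hM.continuousOn_dv c).mono (ordConnected_Icc.uIcc_subset hs ht)).intervalIntegrable)
    (hM.intervalIntegrable_dv hβ hs ht) fun r hr => ?_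
  exact hM.dv_mono (hc r hr) ⟨hs.1.trans hr.1.le, hr.2.le.trans ht.2⟩

theorem rent_le_increment {c : Bundle n} {s t : ℝ} (hs : s ∈ M.T) (ht : t ∈ M.T) (hst : s ≤ t)
    (hc : ∀ r ∈ Ioo s t, β r ⊆ c) : M.rent β t - M.rent β s ≤ M.v c t - M.v c s := by
  rw [hM.rent_sub hβ hs ht, ← hM.integral_dv c hs ht hst]
  refine intervalIntegral.integral_mono_on_of_le_Ioo hst (hM.intervalIntegrable_dv hβ hs ht)
    (((hM.continuousOn_dv c).mono (ordConnected_Icc.uIcc_subset hs ht)).intervalIntegrable)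
    fun r hr => ?_
  exact hM.dv_mono (hc r hr) ⟨hs.1.trans hr.1.le, hr.2.le.trans ht.2⟩

theorem rent_nonneg {t : ℝ} (ht : t ∈ M.T) : 0 ≤ M.rent β t := by
  have := hM.increment_le_rent hβ hM.tLo_mem ht ht.1 (c := ∅) (by simp)
  simpa [hM.v_empty _ ht, hM.v_empty _ hM.tLo_mem, rent] using this

/-- This is incentive compatibility: marginal values grow with the bundle, so an increasing
assignment gives rents at least as steep as that of `β s` above `s`, and at most as steep below. -/
theorem increment_le_rent_sub {s t : ℝ} (hs : s ∈ M.T) (ht : t ∈ M.T) :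
    M.v (β s) t - M.v (β s) s ≤ M.rent β t - M.rent β s := by
  rcases le_total s t with h | h
  · exact hM.increment_le_rent hβ hs ht h fun r hr =>
      hβ hs ⟨hs.1.trans hr.1.le, hr.2.le.trans ht.2⟩ hr.1.le
  · have := hM.rent_le_increment hβ ht hs h (c := β s) fun r hr =>
      hβ ⟨ht.1.trans hr.1.le, hr.2.le.trans hs.2⟩ hs hr.2.le
    linarith

theorem measurable_payment : Measurable fun t : M.T => M.v (β t) t - M.rent β t := by
  refine Measurable.sub ?_ ?_
  · have : (fun t : M.T => M.v (β t) t) =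
        fun t : M.T => ∑ b, (Pi.single (β t) 1 : Bundle n → ℝ) b * M.v b t := by
      ext t
      rw [sum_single_mul _ fun b => M.v b t]
    rw [this]
    refine Finset.measurable_fun_sum _ fun b _ => Measurable.mul ?_ ?_
    · exact (measurable_pi_apply b).comp (measurable_single_of_monotoneOn hβ)
    · exact (continuousOn_iff_continuous_domRestrict.1 (hM.continuousOn_v b)).measurable
  · have := intervalIntegral.continuousOn_primitive_interval
      (f := fun r => M.dv (β r) r) (a := M.tLo) (b := M.tHi) (μ := volume)
      (by rw [uIcc_of_le hM.tLo_lt_tHi.le]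
          exact integrableOn_of_monotoneOn hβ hM.continuousOn_dv)
    rw [uIcc_of_le hM.tLo_lt_tHi.le] at this
    exact (continuousOn_iff_continuous_domRestrict.1 this).measurable

/-- Every increasing deterministic assignment is implementable. -/
theorem isMechanism_of_monotoneOn :
    M.IsMechanism (fun t => Pi.single (β t) 1) (fun t => M.v (β t) t - M.rent β t) where
  assignment t _ := single_mem_stdSimplex ℝ (β t)
  measurable_a := measurable_single_of_monotoneOn hβ
  measurable_p := hM.measurable_payment hβ
  IC t ht s hs := by
    simp only [value_single]
    linarith [hM.increment_le_rent_sub hβ hs ht]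
  IR t ht := by
    simp only [value_single]
    linarith [hM.rent_nonneg hβ ht]

theorem expectedProfit_of_monotoneOn :
    M.expectedProfit (fun t => Pi.single (β t) 1) (fun t => M.v (β t) t - M.rent β t) =
      ∫ t in M.T, M.virtualProfit (β t) t := by
  rw [hM.expectedProfit_eq (hM.isMechanism_of_monotoneOn hβ)]
  simp [value_single, rent, sum_single_mul _ fun b => M.virtualProfit b _]

theorem sellingOptimal_of_forall_le {B : Set (Bundle n)} (hB : ∀ t ∈ M.T, β t ∈ B)
    (hopt : ∀ a p, M.IsMechanism a p →
      M.expectedProfit a p ≤ ∫ t in M.T, M.virtualProfit (β t) t) : M.SellingOptimal B := by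
  refine ⟨_, _, ⟨hM.isMechanism_of_monotoneOn hβ, fun a p h => ?_⟩, fun t ht => ⟨β t, hB t ht, rfl⟩⟩
  rw [hM.expectedProfit_of_monotoneOn hβ]
  exact hopt a p h

end Deterministic

end Assumptions

end BundlingModel

/-! ### From an optimal nested menu to an increasing assignment -/

theorem IsNested.exists_least {n : ℕ} {B S : Set (Bundle n)} (hB : IsNested B) (hS : S ⊆ B)
    (hne : S.Nonempty) : ∃ x ∈ S, ∀ y ∈ S, x ⊆ y := by
  obtain ⟨x, hx, hmin⟩ := S.toFinite.exists_minimal hne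
  refine ⟨x, hx, fun y hy => ?_⟩
  rcases hB x (hS hx) y (hS hy) with h | h
  · exact h
  · exact hmin hy h

theorem IsNested.exists_greatest {n : ℕ} {B S : Set (Bundle n)} (hB : IsNested B) (hS : S ⊆ B)
    (hne : S.Nonempty) : ∃ x ∈ S, ∀ y ∈ S, y ⊆ x := by
  obtain ⟨x, hx, hmax⟩ := S.toFinite.exists_maximal hne
  refine ⟨x, hx, fun y hy => ?_⟩
  rcases hB x (hS hx) y (hS hy) with h | h
  · exact hmax hy h
  · exact h

namespace BundlingModel.Assumptions

variable {n : ℕ} {M : BundlingModel n} (hM : M.Assumptions)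
include hM

/-- The two incentive constraints make the increment from `σ t` to `σ s` at most as large at `t` as
at `s`. As it increases strictly once positive, it vanishes at `t`, and so at all lower types. -/
theorem v_eq_of_decreasing {σ : ℝ → Bundle n} {p : ℝ → ℝ}
    (hIC : ∀ t ∈ M.T, ∀ s ∈ M.T, M.v (σ s) t - p s ≤ M.v (σ t) t - p t) {s t : ℝ}
    (hs : s ∈ M.T) (ht : t ∈ M.T) (hst : s ≤ t) (h : σ t ⊆ σ s) :
    ∀ r ∈ M.T, r ≤ t → M.v (σ s) r = M.v (σ t) r := by
  have key : M.v (σ s) t - M.v (σ t) t ≤ 0 := by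
    rcases hst.eq_or_lt with rfl | hst
    · simp
    rcases h.eq_or_ssubset with h | hss
    · simp [h]
    have h1 := hIC s hs t ht
    have h2 := hIC t ht s hs
    by_contra! hpos
    have := hM.increment_strictMono _ _ hss s hs t ht hst (by linarith)
    linarith
  intro r hr hrt
  have h1 := hM.monotoneOn_increment h hr ht hrt
  have h2 := hM.v_mono _ _ h r hr
  simp only at h1
  linarith

theorem dv_eq_of_eq_below {b c : Bundle n} {t : ℝ} (ht : t ∈ M.T) (hlo : M.tLo < t)
    (h : ∀ r ∈ M.T, r ≤ t → M.v b r = M.v c r) : M.dv b t = M.dv c t := by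
  have hsub : Icc M.tLo t ⊆ M.T := Icc_subset_Icc le_rfl ht.2
  have hb := (hM.hasDerivWithinAt_v b ht).mono hsub
  have hc := (hM.hasDerivWithinAt_v c ht).mono hsub
  have hb' : HasDerivWithinAt (M.v b) (M.dv c t) (Icc M.tLo t) t :=
    hc.congr (fun r hr => h r (hsub hr) hr.2) (h t ht le_rfl)
  exact (uniqueDiffOn_Icc hlo t (right_mem_Icc.2 hlo.le)).eq_deriv _ hb hb'

/-- If selling a nested menu is optimal, then some increasing assignment of its bundles is. -/
theorem exists_monotoneOn_of_sellingOptimal {B : Set (Bundle n)} (hnest : IsNested B)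
    (h : M.SellingOptimal B) :
    ∃ β : ℝ → Bundle n, MonotoneOn β M.T ∧ (∀ t ∈ M.T, β t ∈ B) ∧
      ∀ a p, M.IsMechanism a p →
        M.expectedProfit a p ≤ ∫ t in M.T, M.virtualProfit (β t) t := by
  obtain ⟨a, p, ⟨hmech, hopt⟩, hdet⟩ := h
  choose! σ hσB hσ using hdet
  have hIC : ∀ t ∈ M.T, ∀ s ∈ M.T, M.v (σ s) t - p s ≤ M.v (σ t) t - p t := by
    intro t ht s hs
    have := hmech.IC t ht s hs
    rwa [hσ t ht, hσ s hs, value_single, value_single] at this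
  -- `l t` is the smallest bundle of the types from `t` up, `u t` the largest of those up to `t`.
  -- All bundles between them have the same value at types up to `t`, so only costs distinguish
  -- them.
  have hl : ∀ t ∈ M.T, ∃ x ∈ σ '' (M.T ∩ Ici t), ∀ y ∈ σ '' (M.T ∩ Ici t), x ⊆ y :=
    fun t ht => hnest.exists_least (image_subset_iff.2 fun s hs => hσB s hs.1)
      ⟨_, t, ⟨ht, self_mem_Ici⟩, rfl⟩
  have hu : ∀ t ∈ M.T, ∃ x ∈ σ '' (M.T ∩ Iic t), ∀ y ∈ σ '' (M.T ∩ Iic t), y ⊆ x :=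
    fun t ht => hnest.exists_greatest (image_subset_iff.2 fun s hs => hσB s hs.1)
      ⟨_, t, ⟨ht, self_mem_Iic⟩, rfl⟩
  choose! l hlmem hlmin using hl
  choose! u humem humax using hu
  have hlσ : ∀ t ∈ M.T, l t ⊆ σ t := fun t ht => hlmin t ht _ ⟨t, ⟨ht, self_mem_Ici⟩, rfl⟩
  have hσu : ∀ t ∈ M.T, σ t ⊆ u t := fun t ht => humax t ht _ ⟨t, ⟨ht, self_mem_Iic⟩, rfl⟩
  have hlu : ∀ t ∈ M.T, ∀ r ∈ M.T, r ≤ t → M.v (u t) r = M.v (l t) r := by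
    intro t ht r hr hrt
    obtain ⟨s, ⟨hs, hst⟩, hls⟩ := hlmem t ht
    obtain ⟨s', ⟨hs', hst'⟩, hus⟩ := humem t ht
    rw [← hls, ← hus]
    refine hM.v_eq_of_decreasing hIC hs' hs (le_trans hst' hst) ?_ r hr (hrt.trans hst)
    rw [hls, hus]
    exact (hlσ t ht).trans (hσu t ht)
  -- Take a cheapest bundle of B between `l t` and `u t`, and the largest among the cheapest: both
  -- bounds increase with `t`, so this selection does too.
  have hβ : ∀ t ∈ M.T, ∃ c, (c ∈ B ∧ l t ⊆ c ∧ c ⊆ u t) ∧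
      (∀ d ∈ B, l t ⊆ d → d ⊆ u t → M.C c ≤ M.C d) ∧
      ∀ d ∈ B, l t ⊆ d → d ⊆ u t → M.C d ≤ M.C c → d ⊆ c := by
    intro t ht
    obtain ⟨c, hc, hcmin⟩ := ({c | c ∈ B ∧ l t ⊆ c ∧ c ⊆ u t} : Set (Bundle n)).toFinite.exists_minimalFor
      M.C _ ⟨σ t, hσB t ht, hlσ t ht, hσu t ht⟩
    obtain ⟨c', ⟨hc', hc'C⟩, hmax⟩ := hnest.exists_greatest
      (S := {d | (d ∈ B ∧ l t ⊆ d ∧ d ⊆ u t) ∧ M.C d ≤ M.C c}) (fun d hd => hd.1.1)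
      ⟨c, hc, le_rfl⟩
    have hmin : ∀ d ∈ B, l t ⊆ d → d ⊆ u t → M.C c ≤ M.C d := fun d h1 h2 h3 =>
      (le_total (M.C c) (M.C d)).elim id fun h => hcmin (j := d) ⟨h1, h2, h3⟩ h
    exact ⟨c', hc', fun d h1 h2 h3 => hc'C.trans (hmin d h1 h2 h3),
      fun d h1 h2 h3 h4 => hmax d ⟨⟨h1, h2, h3⟩, h4.trans hc'C⟩⟩
  choose! β hβmem hβmin hβmax using hβ
  have hmono : MonotoneOn β M.T := by
    intro s hs t ht hst
    obtain ⟨hsB, hls, hus⟩ := hβmem s hs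
    obtain ⟨htB, hlt, hut⟩ := hβmem t ht
    have hll : l s ⊆ l t := hlmin s hs _ (by
      obtain ⟨r, ⟨hr, hrt⟩, h⟩ := hlmem t ht
      exact ⟨r, ⟨hr, le_trans hst hrt⟩, h⟩)
    have huu : u s ⊆ u t := humax t ht _ (by
      obtain ⟨r, ⟨hr, hrt⟩, h⟩ := humem s hs
      exact ⟨r, ⟨hr, le_trans hrt hst⟩, h⟩)
    rcases hnest _ hsB _ htB with h | h
    · exact h
    · exact hβmax t ht _ hsB (hlt.trans h) (hus.trans huu)
        (hβmin s hs _ htB (hll.trans hlt) (h.trans hus))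
  refine ⟨β, hmono, fun t ht => (hβmem t ht).1, fun a' p' h' => ?_⟩
  refine (hopt a' p' h').trans ((hM.expectedProfit_le hmech).trans ?_)
  refine setIntegral_mono_on_ae
    (integrableOn_sum_mul hmech.assignment hmech.measurable_a hM.continuousOn_virtualProfit)
    (integrableOn_of_monotoneOn hmono hM.continuousOn_virtualProfit) measurableSet_Icc ?_
  -- Equality of values below `t` determines the derivative only from the left, so the lowest type
  -- is discarded.
  have hlo : ∀ᵐ t : ℝ, t ≠ M.tLo := by simp [ae_iff]
  filter_upwards [hlo] with t hne ht
  rw [hσ t ht, sum_single_mul _ fun b => M.virtualProfit b t]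
  have hveq : ∀ r ∈ M.T, r ≤ t → M.v (σ t) r = M.v (β t) r := by
    intro r hr hrt
    have h1 := hlu t ht r hr hrt
    have h2 := hM.v_mono _ _ (hlσ t ht) r hr
    have h3 := hM.v_mono _ _ (hσu t ht) r hr
    have h4 := hM.v_mono _ _ (hβmem t ht).2.1 r hr
    have h5 := hM.v_mono _ _ (hβmem t ht).2.2 r hr
    linarith
  have hC := hβmin t ht _ (hσB t ht) (hlσ t ht) (hσu t ht)
  rw [virtualProfit, virtualProfit, hM.dv_eq_of_eq_below ht (lt_of_le_of_ne ht.1 hne.symm) hveq,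
    hveq t ht le_rfl]
  have := hM.f_pos t ht
  gcongr

/-! ### Sufficiency: pointwise maximization of virtual profit -/

section Sufficiency

variable {B : Set (Bundle n)} {β : ℝ → Bundle n}

/-- If a larger bundle is chosen at `s` and a smaller one at `t > s`, then `s` is above the larger
bundle's threshold, hence by (i) above both. Single crossing makes the larger bundle strictly better
at `t`. -/
theorem monotoneOn_of_maximizer (hB : ∅ ∈ B) (hnest : IsNested B)
    (hdecr : ∀ b₁ ∈ B, b₁.Nonempty → ∀ b₂ ∈ B, b₁ ⊂ b₂ → M.salesVolume b₂ < M.salesVolume b₁)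
    (hβB : ∀ t ∈ M.T, β t ∈ B)
    (hmax : ∀ t ∈ M.T, ∀ d ∈ B, M.virtualProfit d t ≤ M.virtualProfit (β t) t) :
    MonotoneOn β M.T := by
  intro s hs t ht hst
  by_contra hnot
  have hlt : β t ⊂ β s := by
    rcases hnest _ (hβB s hs) _ (hβB t ht) with h | h
    · exact absurd h hnot
    · exact ⟨h, hnot⟩
  have hst : s < t := lt_of_le_of_ne hst (by rintro rfl; exact hnot le_rfl)
  have hne : (β s).Nonempty := Finset.nonempty_iff_ne_empty.2 fun h => by simp [h] at hlt
  have h0 : 0 ≤ M.virtualProfit (β s) s := hM.virtualProfit_empty hs ▸ hmax s hs ∅ hB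
  have hθ : M.threshold (β s) ≤ s := by
    by_contra! h
    exact absurd h0 (not_le.2 (hM.virtualProfit_neg hne hs h))
  have key : M.virtualProfit (β t) t < M.virtualProfit (β s) t := by
    rcases (β t).eq_empty_or_nonempty with he | hne'
    · rw [he, hM.virtualProfit_empty ht]
      exact hM.virtualProfit_singleCrossing hne hs ht hst h0
    · have := (hM.salesVolume_lt_iff _ _).1 (hdecr _ (hβB t ht) hne' _ (hβB s hs) hlt)
      exact hM.increment_singleCrossing hne' hlt (this.le.trans hθ) hθ ht hst
        (hmax s hs _ (hβB t ht))
  exact absurd (hmax t ht _ (hβB s hs)) (not_le.2 key)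

/-- A bundle that sells less than a larger bundle is dominated, type by type, by the larger bundle
or by no bundle at all. -/
theorem virtualProfit_le_of_dominated {b₁ b₂ : Bundle n} (hb₁ : b₁.Nonempty) (hb : b₁ ⊂ b₂)
    (h : M.salesVolume b₁ ≤ M.salesVolume b₂) {t : ℝ} (ht : t ∈ M.T) :
    M.virtualProfit b₁ t ≤ max 0 (M.virtualProfit b₂ t) := by
  have hθ := (hM.salesVolume_le_iff _ _).1 h
  have hcard : 1 < b₂.card := (Finset.one_le_card.2 hb₁).trans_lt (Finset.card_lt_card hb)
  have hint := hM.threshold_interior hcard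
  have hb₂ : b₂.Nonempty := hb₁.mono hb.1
  rcases lt_or_ge t (M.threshold b₁) with hlt | hge
  · exact (hM.virtualProfit_neg hb₁ ht hlt).le.trans (le_max_left _ _)
  refine le_trans ?_ (le_max_right _ _)
  -- At the threshold of `b₁` the virtual profit of `b₁` is at most zero and that of `b₂` at least
  -- zero; single crossing propagates this order upwards.
  have h1 := hM.virtualProfit_threshold_nonpos hb₁ (hint.1.trans_le hθ)
  have h2 : 0 ≤ M.virtualProfit b₂ (M.threshold b₁) := by
    rcases hθ.eq_or_lt with he | hlt
    · exact he ▸ hM.virtualProfit_threshold_nonneg hb₂ hint.2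
    · exact (hM.virtualProfit_pos hb₂ (hM.threshold_mem b₁) hlt).le
  rcases hge.eq_or_lt with he | hlt
  · exact he ▸ h1.trans h2
  · exact (hM.increment_singleCrossing hb₁ hb le_rfl hθ ht hlt (h1.trans h2)).le

theorem sellingOptimal_of_conditions (hB : ∅ ∈ B) (hnest : IsNested B)
    (hdecr : ∀ b₁ ∈ B, b₁.Nonempty → ∀ b₂ ∈ B, b₁ ⊂ b₂ → M.salesVolume b₂ < M.salesVolume b₁)
    (hdom : ∀ b₁ ∉ B, ∃ b₂ ∈ B, b₁ ⊂ b₂ ∧ M.salesVolume b₁ ≤ M.salesVolume b₂) :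
    M.SellingOptimal B := by
  choose β hβB hmax using fun t : ℝ =>
    exists_max_image B (fun b => M.virtualProfit b t) B.toFinite ⟨_, hB⟩
  have hmono := hM.monotoneOn_of_maximizer hB hnest hdecr (fun t _ => hβB t) (fun t _ => hmax t)
  refine hM.sellingOptimal_of_forall_le hmono (fun t _ => hβB t) fun a p hmech => ?_
  refine (hM.expectedProfit_le hmech).trans (setIntegral_mono_on
    (integrableOn_sum_mul hmech.assignment hmech.measurable_a hM.continuousOn_virtualProfit)
    (integrableOn_of_monotoneOn hmono hM.continuousOn_virtualProfit) M.measurableSet_T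
    fun t ht => ?_)
  have hle : ∀ b, M.virtualProfit b t ≤ M.virtualProfit (β t) t := by
    intro b
    by_cases hb : b ∈ B
    · exact hmax t b hb
    · obtain ⟨b₂, hb₂, hss, hvol⟩ := hdom b hb
      have hne : b.Nonempty := Finset.nonempty_iff_ne_empty.2 fun h => hb (h ▸ hB)
      refine (hM.virtualProfit_le_of_dominated hne hss hvol ht).trans
        (max_le ?_ (hmax t b₂ hb₂))
      exact hM.virtualProfit_empty ht ▸ hmax t ∅ hB
  have ha := hmech.assignment t ht
  calc ∑ b, a t b * M.virtualProfit b t ≤ ∑ b, a t b * M.virtualProfit (β t) t :=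
        Finset.sum_le_sum fun b _ => mul_le_mul_of_nonneg_left (hle b) (ha.1 b)
    _ = M.virtualProfit (β t) t := by rw [← Finset.sum_mul, ha.2, one_mul]

end Sufficiency

/-! ### A profitable lottery below the smallest bundle -/

section Lottery

/-- With zero marginal value, a zero virtual profit would mean price equal to cost at the threshold.
Tail profit would be zero there and at the top type, yet it strictly decreases in between. -/
theorem dv_threshold_pos {c : Bundle n} (hc : c.Nonempty)
    (hθ : M.threshold c ∈ Ioo M.tLo M.tHi) : 0 < M.dv c (M.threshold c) := by
  have hm := hM.threshold_mem c
  refine lt_of_le_of_ne (hM.dv_nonneg c hm) fun h0 => ?_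
  have hψ : M.virtualProfit c (M.threshold c) = 0 := le_antisymm
    (hM.virtualProfit_threshold_nonpos hc hθ.1) (hM.virtualProfit_threshold_nonneg hc hθ.2)
  rw [virtualProfit, ← h0, mul_zero, sub_zero] at hψ
  have hv := (mul_eq_zero.1 hψ).resolve_right (hM.f_pos _ hm).ne'
  have hanti : StrictAntiOn (M.tailProfit c) (Icc (M.threshold c) M.tHi) := by
    refine strictAntiOn_of_deriv_neg (convex_Icc _ _)
      ((hM.continuousOn_tailProfit c).mono (Icc_subset_Icc hm.1 le_rfl)) fun s hs => ?_
    rw [interior_Icc] at hs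
    rw [(hM.hasDerivAt_tailProfit c ⟨hm.1.trans_lt hs.1, hs.2⟩).deriv, neg_lt_zero]
    exact hM.virtualProfit_pos hc ⟨hm.1.trans hs.1.le, hs.2.le⟩ hs.1
  have := hanti (left_mem_Icc.2 hm.2) (right_mem_Icc.2 hm.2) hθ.2
  simp [tailProfit, hv, hM.cdf_tHi] at this

theorem exists_small_increment {b c : Bundle n} {τ : ℝ} (hτ : τ ∈ Ioo M.tLo M.tHi)
    (hc : 0 < M.dv c τ) :
    ∃ ε ∈ Ioc (0 : ℝ) 1, ∀ t ∈ M.T,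
      (τ ≤ t → ε * (M.v b t - M.v b τ) ≤ M.v c t - M.v c τ) ∧
      (t ≤ τ → ε * (M.v b τ - M.v b t) ≤ M.v c τ - M.v c t) := by
  have hτT : τ ∈ M.T := Ioo_subset_Icc_self hτ
  have hnhds : M.T ∈ 𝓝 τ := Icc_mem_nhds hτ.1 hτ.2
  have hdiff : ∀ b, HasDerivAt (M.v b) (M.dv b τ) τ := fun b =>
    (hM.hasDerivWithinAt_v b hτT).hasDerivAt hnhds
  have hcont : ∀ b, ContinuousOn (dslope (M.v b) τ) M.T := fun b =>
    (continuousOn_dslope hnhds).2 ⟨hM.continuousOn_v b, (hdiff b).differentiableAt⟩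
  have hdec : ∀ t ∈ M.T, t < τ → M.v c t < M.v c τ := by
    intro t ht htτ
    obtain ⟨w, hw, hlt⟩ := (hM.hasDerivWithinAt_v c hτT).exists_lt_left hc ht.1 htτ hτT.2
    exact (hM.monotoneOn_v c ht ⟨ht.1.trans hw.1.le, hw.2.le.trans hτT.2⟩ hw.1.le).trans_lt hlt
  have hpos : 0 < M.v c τ := (hM.v_nonneg c hM.tLo_mem).trans_lt (hdec _ hM.tLo_mem hτ.1)
  have hslope : ∀ t ∈ M.T, 0 < dslope (M.v c) τ t := by
    intro t ht
    rcases lt_trichotomy t τ with h | rfl | h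
    · rw [dslope_of_ne _ h.ne, slope_def_field]
      exact div_pos_of_neg_of_neg (sub_neg.2 (hdec t ht h)) (sub_neg.2 h)
    · rwa [dslope_same, (hdiff c).deriv]
    · rw [dslope_of_ne _ h.ne', slope_def_field]
      exact div_pos (sub_pos.2 (hM.v_strictMono c τ hτT t ht h hpos)) (sub_pos.2 h)
  obtain ⟨x, hx, hmin⟩ := isCompact_Icc.exists_isMinOn ⟨_, hM.tLo_mem⟩ (hcont c)
  obtain ⟨y, hy, hmax⟩ := isCompact_Icc.exists_isMaxOn ⟨_, hM.tLo_mem⟩ (hcont b)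
  set m := dslope (M.v c) τ x
  set L := dslope (M.v b) τ y
  have hm : 0 < m := hslope x hx
  -- By compactness the difference quotients of `c` at `τ` are at least `m > 0` and those of `b` at
  -- most `L`, so this probability makes the increments of `b` negligible against those of `c`.
  refine ⟨min 1 (m / (|L| + 1)), ⟨by positivity, min_le_left _ _⟩, fun t ht => ?_⟩
  set ε := min 1 (m / (|L| + 1)) with hε
  have hε0 : 0 < ε := by positivity
  have hεm : ε * (|L| + 1) ≤ m := (le_div_iff₀ (by positivity)).1 (min_le_right _ _)
  have hle : ε * dslope (M.v b) τ t ≤ dslope (M.v c) τ t := by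
    have h1 : dslope (M.v b) τ t ≤ L := hmax ht
    have h2 : m ≤ dslope (M.v c) τ t := hmin ht
    refine le_trans ?_ (hεm.trans h2)
    gcongr
    linarith [le_abs_self L]
  have hb := sub_smul_dslope (M.v b) τ t
  have hc' := sub_smul_dslope (M.v c) τ t
  rw [smul_eq_mul] at hb hc'
  rw [← neg_sub (M.v b t), ← neg_sub (M.v c t), ← hb, ← hc']
  constructor <;> intro h <;> nlinarith

/-- If a bundle `b` sells more than the smallest bundle `c` on offer, then it is profitable to add
a lottery over `b` for the types who buy nothing. -/
theorem exists_lottery_improvement {β : ℝ → Bundle n} (hβ : MonotoneOn β M.T) {b c : Bundle n}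
    (hb : b.Nonempty) (hc : c.Nonempty) (hbc : M.threshold b < M.threshold c)
    (hcHi : M.threshold c < M.tHi) (hbelow : ∀ t ∈ M.T, t < M.threshold c → β t = ∅)
    (habove : ∀ t ∈ M.T, M.threshold c < t → c ⊆ β t) :
    ∃ a p, M.IsMechanism a p ∧ ∫ t in M.T, M.virtualProfit (β t) t < M.expectedProfit a p := by
  have hθ := hM.threshold_mem b
  have hτ := hM.threshold_mem c
  have hψc := hM.dv_threshold_pos hc ⟨hθ.1.trans_lt hbc, hcHi⟩
  obtain ⟨ε, ⟨hε0, hε1⟩, hε⟩ := hM.exists_small_increment (b := b)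
    ⟨hθ.1.trans_lt hbc, hcHi⟩ hψc
  have hψθ := hM.virtualProfit_threshold_nonneg hb (hbc.trans hcHi)
  have hψb := fun t => hM.virtualProfit_pos (t := t) hb
  generalize M.threshold b = θ at *
  generalize M.threshold c = τ at *
  have hrent : M.rent β τ = 0 := by
    refine le_antisymm ?_ (hM.rent_nonneg hβ hτ)
    have := hM.rent_le_increment hβ hM.tLo_mem hτ hτ.1 (c := ∅) fun r hr =>
      (hbelow r ⟨hr.1.le, hr.2.le.trans hτ.2⟩ hr.2).le
    simpa [hM.v_empty _ hτ, hM.v_empty _ hM.tLo_mem, rent] using this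
  -- The rent that the lottery leaves to type `τ`. All higher types get it as a discount, so utility
  -- `W` stays continuous at `τ` and zero at the bottom.
  set κ := ε * (M.v b τ - M.v b θ) with hκ
  have hκ0 : 0 ≤ κ := mul_nonneg hε0.le (sub_nonneg.2 (hM.monotoneOn_v b hθ hτ hbc.le))
  set ℓ : Bundle n → ℝ := ε • Pi.single b 1 + (1 - ε) • Pi.single ∅ 1 with hℓ
  have hℓsum : ∀ g : Bundle n → ℝ, ∑ d, ℓ d * g d = ε * g b + (1 - ε) * g ∅ := by
    intro g
    simp only [hℓ, Pi.add_apply, Pi.smul_apply, smul_eq_mul, add_mul, mul_assoc,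
      Finset.sum_add_distrib, ← Finset.mul_sum, sum_single_mul]
  have hℓv : ∀ t ∈ M.T, M.value ℓ t = ε * M.v b t := by
    intro t ht
    rw [value, hℓsum fun d => M.v d t, hM.v_empty t ht, mul_zero, add_zero]
  set a : ℝ → Bundle n → ℝ := fun t =>
    if t < θ then Pi.single ∅ 1 else if t ≤ τ then ℓ else Pi.single (β t) 1 with ha
  set p : ℝ → ℝ := fun t =>
    if t < θ then 0 else if t ≤ τ then ε * M.v b θ else M.v (β t) t - M.rent β t - κ with hp
  set W : ℝ → ℝ := fun t =>
    if t < θ then 0 else if t ≤ τ then ε * (M.v b t - M.v b θ) else M.rent β t + κ with hW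
  have hWeq : ∀ t ∈ M.T, M.value (a t) t - p t = W t := by
    intro t ht
    simp only [ha, hp, hW]
    split_ifs
    · rw [value_single, hM.v_empty t ht, sub_zero]
    · rw [hℓv t ht, mul_sub]
    · rw [value_single]
      ring
  have hW0 : ∀ t ∈ M.T, 0 ≤ W t := by
    intro t ht
    simp only [hW]
    split_ifs with h1 h2
    · exact le_rfl
    · exact mul_nonneg hε0.le (sub_nonneg.2 (hM.monotoneOn_v b hθ ht (not_lt.1 h1)))
    · exact add_nonneg (hM.rent_nonneg hβ ht) hκ0
  have hWb : ∀ t ∈ M.T, ε * (M.v b t - M.v b θ) ≤ W t := by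
    intro t ht
    simp only [hW]
    split_ifs with h1 h2
    · exact mul_nonpos_of_nonneg_of_nonpos hε0.le
        (sub_nonpos.2 (hM.monotoneOn_v b ht hθ h1.le))
    · exact le_rfl
    · have h3 := hM.increment_le_rent hβ hτ ht (not_le.1 h2).le (c := c) fun r hr =>
        habove r ⟨hτ.1.trans hr.1.le, hr.2.le.trans ht.2⟩ hr.1
      have h4 := (hε t ht).1 (not_le.1 h2).le
      rw [hκ]
      linarith
  have hWβ : ∀ t ∈ M.T, ∀ s ∈ M.T, τ < s →
      M.v (β s) t - (M.v (β s) s - M.rent β s - κ) ≤ W t := by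
    intro t ht s hs hτs
    rcases le_or_gt t τ with h | h
    -- A low type who mimics `s > τ` loses at least the increment of `c` from `t` to `τ`, which
    -- exceeds the scaled increment of `b`.
    · refine le_trans ?_ (hWb t ht)
      have h1 := hM.increment_le_rent_sub hβ hs hτ
      have h2 := hM.monotoneOn_increment (habove s hs hτs) ht hτ h
      have h3 := (hε t ht).2 h
      simp only at h2
      rw [hκ]
      linarith
    · have h1 := hM.increment_le_rent_sub hβ hs ht
      have h2 : W t = M.rent β t + κ := by
        simp only [hW]
        rw [if_neg (not_lt.2 (hbc.trans h).le), if_neg (not_le.2 h)]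
      linarith
  have hmech : M.IsMechanism a p := by
    have hmeas1 : MeasurableSet {t : M.T | (t : ℝ) < θ} :=
      measurableSet_lt measurable_subtype_coe measurable_const
    have hmeas2 : MeasurableSet {t : M.T | (t : ℝ) ≤ τ} :=
      measurableSet_le measurable_subtype_coe measurable_const
    refine ⟨fun t ht => ?_, ?_, ?_, fun t ht s hs => ?_, fun t ht => ?_⟩
    · simp only [ha]
      split_ifs
      · exact single_mem_stdSimplex ℝ _
      · exact convex_stdSimplex ℝ _ (single_mem_stdSimplex ℝ _) (single_mem_stdSimplex ℝ _)
          hε0.le (sub_nonneg.2 hε1) (by ring)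
      · exact single_mem_stdSimplex ℝ _
    · exact Measurable.ite hmeas1 measurable_const
        (Measurable.ite hmeas2 measurable_const (measurable_single_of_monotoneOn hβ))
    · exact Measurable.ite hmeas1 measurable_const (Measurable.ite hmeas2 measurable_const
        ((hM.measurable_payment hβ).sub measurable_const))
    · rw [hWeq t ht]
      simp only [ha, hp]
      split_ifs with h1 h2
      · rw [value_single, hM.v_empty t ht, sub_zero]
        exact hW0 t ht
      · rw [hℓv t ht, ← mul_sub]
        exact hWb t ht
      · rw [value_single]
        exact hWβ t ht s hs (not_le.1 h2)
    · rw [hWeq t ht]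
      exact hW0 t ht
  have hWlo : W M.tLo = 0 := by
    simp only [hW]
    rcases hθ.1.eq_or_lt with h | h
    · simp [← h, hτ.1]
    · rw [if_pos h]
  refine ⟨a, p, hmech, ?_⟩
  rw [hM.expectedProfit_eq hmech, hWeq _ hM.tLo_mem, hWlo, sub_zero]
  have hmid : ∀ t ∈ M.T, θ ≤ t → t < τ →
      ∑ d, a t d * M.virtualProfit d t = ε * M.virtualProfit b t := by
    intro t ht h1 h2
    simp only [ha]
    rw [if_neg (not_lt.2 h1), if_pos h2.le, hℓsum fun d => M.virtualProfit d t,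
      hM.virtualProfit_empty ht, mul_zero, add_zero]
  refine setIntegral_Icc_lt_of_lt_Ioo (z := τ) (u := θ) (w := τ)
    (integrableOn_of_monotoneOn hβ hM.continuousOn_virtualProfit)
    (integrableOn_sum_mul hmech.assignment hmech.measurable_a hM.continuousOn_virtualProfit)
    (fun t ht hne => ?_) hbc hθ.1 hτ.2 fun t ht => ?_
  · rcases hne.lt_or_gt with h | h
    · rw [hbelow t ht h, hM.virtualProfit_empty ht]
      rcases lt_or_ge t θ with h' | h'
      · simp only [ha]
        rw [if_pos h', sum_single_mul _ fun d => M.virtualProfit d t, hM.virtualProfit_empty ht]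
      · rw [hmid t ht h' h]
        refine mul_nonneg hε0.le ?_
        rcases h'.eq_or_lt with rfl | h'
        · exact hψθ
        · exact (hψb t ht h').le
    · simp only [ha]
      rw [if_neg (not_lt.2 (hbc.trans h).le), if_neg (not_le.2 h),
        sum_single_mul _ fun d => M.virtualProfit d t]
  · have htT : t ∈ M.T := ⟨hθ.1.trans ht.1.le, ht.2.le.trans hτ.2⟩
    rw [hbelow t htT ht.2, hM.virtualProfit_empty htT, hmid t htT ht.1.le ht.2]
    exact mul_pos hε0 (hψb t htT ht.1)

end Lottery

end BundlingModel.Assumptions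

/-! ### Necessity: local variations and the chain of thresholds -/

theorem IsNested.exists_predecessor {n : ℕ} {B : Set (Bundle n)} (hnest : IsNested B)
    (hB : ∅ ∈ B) {c : Bundle n} (hc : c.Nonempty) :
    ∃ d ∈ B, d ⊂ c ∧ ∀ e ∈ B, e ⊂ c → e ⊆ d := by
  obtain ⟨d, ⟨hd, hdc⟩, hmax⟩ := hnest.exists_greatest (S := {e | e ∈ B ∧ e ⊂ c})
    (fun e he => he.1) ⟨∅, hB, Finset.empty_ssubset.2 hc⟩
  exact ⟨d, hd, hdc, fun e he hec => hmax e ⟨he, hec⟩⟩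

namespace BundlingModel

variable {n : ℕ} {M : BundlingModel n}

/-- An increasing assignment that is optimal among all mechanisms. -/
structure IsOptimalAssignment (M : BundlingModel n) (β : ℝ → Bundle n) : Prop where
  monotoneOn : MonotoneOn β M.T
  optimal : ∀ a p, M.IsMechanism a p →
    M.expectedProfit a p ≤ ∫ t in M.T, M.virtualProfit (β t) t

/-- The bundle `c` is sold to all types above `τ`, being the exact assignment up to `w`, and to no
type below `τ`. -/
structure IsEntry (M : BundlingModel n) (β : ℝ → Bundle n) (c : Bundle n) (τ w : ℝ) : Prop where
  mem : τ ∈ M.T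
  lt : τ < w
  mem_right : w ∈ M.T
  above : ∀ t ∈ M.T, τ < t → c ⊆ β t
  below : ∀ t ∈ M.T, t < τ → β t ⊂ c
  eq : ∀ t ∈ M.T, τ < t → t ≤ w → β t = c

theorem exists_isEntry {B : Set (Bundle n)} {β : ℝ → Bundle n} (hnest : IsNested B)
    (hβ : MonotoneOn β M.T) (hβB : ∀ t ∈ M.T, β t ∈ B) {c : Bundle n} (hc : c ∈ B) {s t : ℝ} (hs : s ∈ M.T)
    (ht : t ∈ M.T) (hst : s < t) (hsc : β s = c) (htc : β t = c) :
    ∃ τ, M.IsEntry β c τ t := by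
  -- The entry type is the infimum of the types who get at least `c`; the bundle at this type itself
  -- is left open.
  set S := {r | r ∈ M.T ∧ c ⊆ β r} with hS
  have hbdd : BddBelow S := ⟨M.tLo, fun r hr => hr.1.1⟩
  have hsS : s ∈ S := ⟨hs, hsc.ge⟩
  have hle : sInf S ≤ s := csInf_le hbdd hsS
  have habove : ∀ r ∈ M.T, sInf S < r → c ⊆ β r := by
    intro r hr h
    obtain ⟨x, hx, hxr⟩ := exists_lt_of_csInf_lt ⟨s, hsS⟩ h
    exact hx.2.trans (hβ hx.1 hr hxr.le)
  refine ⟨sInf S, ⟨le_csInf ⟨s, hsS⟩ fun r hr => hr.1.1, hle.trans hs.2⟩, hle.trans_lt hst, ht,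
    habove, fun r hr h => ?_, fun r hr h1 h2 => ?_⟩
  · have hnot : ¬ c ⊆ β r := fun hc => not_le.2 h (csInf_le hbdd ⟨hr, hc⟩)
    exact ⟨(hnest _ hc _ (hβB r hr)).resolve_left hnot, hnot⟩
  · exact subset_antisymm (htc ▸ hβ hr ht h2) (habove r hr h1)

namespace Assumptions

variable (hM : M.Assumptions) {B : Set (Bundle n)} {β : ℝ → Bundle n}
include hM

theorem no_local_improvement (hβ : M.IsOptimalAssignment β) {β' : ℝ → Bundle n}
    (hβ' : MonotoneOn β' M.T) {u w z : ℝ} (huw : u < w) (hu : u ∈ M.T) (hw : w ∈ M.T)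
    (hlt : ∀ t ∈ Ioo u w, M.virtualProfit (β t) t < M.virtualProfit (β' t) t)
    (hle : ∀ t ∈ M.T, t ≠ z → M.virtualProfit (β t) t ≤ M.virtualProfit (β' t) t) : False := by
  have h1 := hβ.optimal _ _ (hM.isMechanism_of_monotoneOn hβ')
  rw [hM.expectedProfit_of_monotoneOn hβ'] at h1
  exact absurd h1 (not_le.2 (setIntegral_Icc_lt_of_lt_Ioo
    (integrableOn_of_monotoneOn hβ.monotoneOn hM.continuousOn_virtualProfit)
    (integrableOn_of_monotoneOn hβ' hM.continuousOn_virtualProfit) hle huw hu.1 hw.2 hlt))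

/-- Every bundle of a minimally optimal menu is sold to an interval of types. -/
theorem exists_lt_of_minimallyOptimal (hB : ∅ ∈ B) (hnest : IsNested B)
    (hmin : ∀ B' : Set (Bundle n), IsMenu B' → B' ⊂ B → ¬ M.SellingOptimal B')
    (hβ : M.IsOptimalAssignment β) (hβB : ∀ t ∈ M.T, β t ∈ B) {c : Bundle n} (hc : c ∈ B)
    (hne : c.Nonempty) : ∃ s ∈ M.T, ∃ t ∈ M.T, s < t ∧ β s = c ∧ β t = c := by
  by_contra! hcon
  obtain ⟨d, hd, hdc, hdmax⟩ := hnest.exists_predecessor hB hne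
  have hz : ∃ z, ∀ t ∈ M.T, t ≠ z → β t ≠ c := by
    by_cases h : ∃ z ∈ M.T, β z = c
    · obtain ⟨z, hz, hzc⟩ := h
      refine ⟨z, fun t ht hne htc => ?_⟩
      rcases hne.lt_or_gt with h | h
      · exact hcon t ht z hz h htc hzc
      · exact hcon z hz t ht h hzc htc
    · exact ⟨0, fun t ht _ htc => h ⟨t, ht, htc⟩⟩
  obtain ⟨z, hz⟩ := hz
  -- At most one type gets `c`; giving it the predecessor keeps monotonicity and the integral, so
  -- `c` is dispensable.
  have hmono : MonotoneOn (fun t => if β t = c then d else β t) M.T := by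
    intro s hs t ht hst
    have h := hβ.monotoneOn hs ht hst
    simp only
    split_ifs with h1 h2 h2
    · exact le_rfl
    · exact hdc.1.trans (h1 ▸ h)
    · exact hdmax _ (hβB s hs) (lt_of_le_of_ne (h2 ▸ h) h1)
    · exact h
  refine hmin (B \ {c}) ⟨hB, fun h => ?_⟩ ⟨sdiff_subset, fun h => (h hc).2 rfl⟩
    (hM.sellingOptimal_of_forall_le hmono (fun t ht => ?_) fun a p hmech => ?_)
  · exact hne.ne_empty h.symm
  · split_ifs with h
    · exact ⟨hd, hdc.ne⟩
    · exact ⟨hβB t ht, h⟩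
  · refine (hβ.optimal a p hmech).trans_eq (setIntegral_congr_ae M.measurableSet_T ?_)
    have : ∀ᵐ t : ℝ, t ≠ z := by simp [ae_iff]
    filter_upwards [this] with t htz ht
    rw [if_neg (hz t ht htz)]

/-- First-order condition against selling the smaller bundle `d` to some more types. -/
theorem virtualProfit_le_of_isEntry (hβ : M.IsOptimalAssignment β) {c d : Bundle n} {τ w : ℝ}
    (hτ : M.IsEntry β c τ w) (hdc : d ⊆ c) (hd : ∀ t ∈ M.T, t < τ → β t ⊆ d) :
    M.virtualProfit d τ ≤ M.virtualProfit c τ := by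
  by_contra! h
  obtain ⟨x, hτx, hxw, hlt⟩ := hM.exists_right_lt hτ.mem hτ.lt h
  have hx : x ∈ M.T := ⟨hτ.mem.1.trans hτx.le, hxw.le.trans hτ.mem_right.2⟩
  -- Intersecting with `d` up to `x` changes nothing below `τ` and replaces `c` by `d` between `τ`
  -- and `x`.
  have hmono : MonotoneOn (fun t => if t ≤ x then β t ∩ d else β t) M.T := by
    intro r hr t ht hrt
    have h := hβ.monotoneOn hr ht hrt
    simp only
    split_ifs with h1 h2 h2
    · exact Finset.inter_subset_inter_right h
    · exact Finset.inter_subset_left.trans h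
    · exact absurd (hrt.trans h2) h1
    · exact h
  have hmid : ∀ t ∈ M.T, τ < t → t ≤ x →
      M.virtualProfit (β t) t < M.virtualProfit (if t ≤ x then β t ∩ d else β t) t := by
    intro t ht h1 h2
    rw [if_pos h2, hτ.eq t ht h1 (h2.trans hxw.le), Finset.inter_eq_right.2 hdc]
    exact hlt t ht h1.le h2
  refine hM.no_local_improvement hβ hmono (z := τ) hτx hτ.mem hx
    (fun t ht => hmid t ⟨hτ.mem.1.trans ht.1.le, ht.2.le.trans hx.2⟩ ht.1 ht.2.le)
    fun t ht hne => ?_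
  rcases hne.lt_or_gt with h | h
  · rw [if_pos (h.trans hτx).le, Finset.inter_eq_left.2 (hd t ht h)]
  · by_cases htx : t ≤ x
    · exact (hmid t ht h htx).le
    · rw [if_neg htx]

/-- First-order condition against selling the larger bundle `c` to some more types. -/
theorem virtualProfit_ge_of_isEntry (hβ : M.IsOptimalAssignment β) {c d : Bundle n} {τ w u : ℝ}
    (hτ : M.IsEntry β c τ w) (hdc : d ⊆ c) (hu : u ∈ M.T) (huτ : u < τ)
    (hd : ∀ t ∈ M.T, u < t → t < τ → β t = d) :
    M.virtualProfit c τ ≤ M.virtualProfit d τ := by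
  by_contra! h
  obtain ⟨x, hux, hxτ, hlt⟩ := hM.exists_left_lt hτ.mem huτ h
  have hx : x ∈ M.T := ⟨hu.1.trans hux.le, hxτ.le.trans hτ.mem.2⟩
  have hmono : MonotoneOn (fun t => if t < x then β t else β t ∪ c) M.T := by
    intro r hr t ht hrt
    have h := hβ.monotoneOn hr ht hrt
    simp only
    split_ifs with h1 h2 h2
    · exact h
    · exact h.trans Finset.subset_union_left
    · exact absurd (hrt.trans_lt h2) h1
    · exact Finset.union_subset_union_left h
  have hmid : ∀ t ∈ M.T, x ≤ t → t < τ →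
      M.virtualProfit (β t) t < M.virtualProfit (if t < x then β t else β t ∪ c) t := by
    intro t ht h1 h2
    rw [if_neg (not_lt.2 h1), hd t ht (hux.trans_le h1) h2, Finset.union_eq_right.2 hdc]
    exact hlt t ht h1 h2.le
  refine hM.no_local_improvement hβ hmono (z := τ) hxτ hx hτ.mem
    (fun t ht => hmid t ⟨hx.1.trans ht.1.le, ht.2.le.trans hτ.mem.2⟩ ht.1.le ht.2)
    fun t ht hne => ?_
  rcases hne.lt_or_gt with h | h
  · by_cases htx : t < x
    · rw [if_pos htx]
    · exact (hmid t ht (not_lt.1 htx) h).le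
  · rw [if_neg (not_lt.2 (hxτ.trans h).le), Finset.union_eq_left.2 (hτ.above t ht h)]

/-- The smallest bundle on offer is sold at its stand-alone optimal price. -/
theorem threshold_eq_of_isEntry (hβ : M.IsOptimalAssignment β) {c : Bundle n} {τ w : ℝ}
    (hc : c.Nonempty) (hτ : M.IsEntry β c τ w) (hbelow : ∀ t ∈ M.T, t < τ → β t = ∅) :
    M.threshold c = τ := by
  have h1 := hM.virtualProfit_le_of_isEntry hβ hτ (Finset.empty_subset c)
    fun t ht h => (hbelow t ht h).le
  rw [hM.virtualProfit_empty hτ.mem] at h1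
  have hle : M.threshold c ≤ τ := by
    by_contra! h
    exact absurd h1 (not_le.2 (hM.virtualProfit_neg hc hτ.mem h))
  refine le_antisymm hle ?_
  by_contra! h
  have h2 := hM.virtualProfit_ge_of_isEntry hβ hτ (Finset.empty_subset c) hM.tLo_mem
    ((hM.threshold_mem c).1.trans_lt h) fun t ht _ h => hbelow t ht h
  rw [hM.virtualProfit_empty hτ.mem] at h2
  exact absurd h2 (not_le.2 (hM.virtualProfit_pos hc hτ.mem h))

/-- An upgrade from `d` to `c` that is sold to fewer types than `d` has a smaller stand-alone
sales volume than `d`. -/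
theorem threshold_lt_of_isEntry (hβ : M.IsOptimalAssignment β) {c d : Bundle n}
    {τ w τ' w' : ℝ} (hd : d.Nonempty) (hdc : d ⊂ c) (hτ : M.IsEntry β c τ w)
    (hτ' : M.IsEntry β d τ' w') (hbelow : ∀ t ∈ M.T, t < τ → β t ⊆ d)
    (hθd : M.threshold d ≤ τ') : M.threshold d < M.threshold c ∧ M.threshold c ≤ τ := by
  have hlt : τ' < τ := by
    refine hτ'.lt.trans_le ?_
    by_contra! h
    have := hτ.above w' hτ'.mem_right h
    rw [hτ'.eq w' hτ'.mem_right hτ'.lt le_rfl] at this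
    exact hdc.2 this
  have hc : c.Nonempty := hd.mono hdc.1
  have hint := hM.threshold_interior
    ((Finset.one_le_card.2 hd).trans_lt (Finset.card_lt_card hdc))
  have heq : M.virtualProfit c τ = M.virtualProfit d τ := le_antisymm
    (hM.virtualProfit_ge_of_isEntry hβ hτ hdc.1 hτ'.mem hlt fun t ht h1 h2 =>
      subset_antisymm (hbelow t ht h2) (hτ'.above t ht h1))
    (hM.virtualProfit_le_of_isEntry hβ hτ hdc.1 hbelow)
  constructor
  -- Otherwise ψ_c ≥ 0 ≥ ψ_d at the threshold of `d`, and single crossing would make ψ_c > ψ_d at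
  -- `τ`, against the first-order equality.
  · by_contra! h
    have h1 : M.virtualProfit c (M.threshold d) < M.virtualProfit d (M.threshold d) := by
      by_contra! h'
      exact absurd heq (hM.increment_singleCrossing hd hdc le_rfl h hτ.mem
        (hθd.trans_lt hlt) h').ne'
    have h2 : 0 ≤ M.virtualProfit c (M.threshold d) := by
      rcases h.eq_or_lt with he | h
      · exact he ▸ hM.virtualProfit_threshold_nonneg hc hint.2
      · exact (hM.virtualProfit_pos hc (hM.threshold_mem d) h).le
    exact absurd (h2.trans_lt h1)
      (not_lt.2 (hM.virtualProfit_threshold_nonpos hd (hint.1.trans_le h)))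
  · by_contra! h
    have h1 := hM.virtualProfit_neg hc hτ.mem h
    have h2 := hM.virtualProfit_pos hd hτ.mem (hθd.trans_lt hlt)
    linarith

/-- Induction along the chain. The bound of the entry type by the threshold is carried along because
the step from `d` to `c` needs it for `d`. -/
theorem threshold_lt_of_ssubset (hB : ∅ ∈ B) (hnest : IsNested B)
    (hβ : M.IsOptimalAssignment β) (hβB : ∀ t ∈ M.T, β t ∈ B)
    (hentry : ∀ c ∈ B, c.Nonempty → ∃ τ w, M.IsEntry β c τ w) (k : ℕ) :
    ∀ c ∈ B, c.Nonempty → c.card = k →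
      (∀ τ w, M.IsEntry β c τ w → M.threshold c ≤ τ) ∧
      ∀ e ∈ B, e.Nonempty → e ⊂ c → M.threshold e < M.threshold c := by
  induction k using Nat.strong_induction_on with
  | _ k ih =>
    intro c hc hne hk
    obtain ⟨d, hdB, hdc, hdmax⟩ := hnest.exists_predecessor hB hne
    have hbelow : ∀ τ w, M.IsEntry β c τ w → ∀ t ∈ M.T, t < τ → β t ⊆ d :=
      fun τ w h t ht htτ => hdmax _ (hβB t ht) (h.below t ht htτ)
    rcases d.eq_empty_or_nonempty with rfl | hd
    · refine ⟨fun τ w h => (hM.threshold_eq_of_isEntry hβ hne h fun t ht htτ =>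
        Finset.subset_empty.1 (hbelow τ w h t ht htτ)).le, fun e he hen hec => ?_⟩
      exact absurd (Finset.subset_empty.1 (hdmax e he hec)) hen.ne_empty
    · obtain ⟨hd1, hd2⟩ := ih d.card (hk ▸ Finset.card_lt_card hdc) d hdB hd rfl
      obtain ⟨τ', w', h'⟩ := hentry d hdB hd
      have key := fun τ w (h : M.IsEntry β c τ w) => hM.threshold_lt_of_isEntry hβ hd hdc h h'
        (hbelow τ w h) (hd1 τ' w' h')
      refine ⟨fun τ w h => (key τ w h).2, fun e he hen hec => ?_⟩
      obtain ⟨τ, w, h⟩ := hentry c hc hne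
      rcases (hdmax e he hec).eq_or_ssubset with rfl | hed
      · exact (key τ w h).1
      · exact (hd2 e he hen hed).trans (key τ w h).1

/-- There is no distortion at the top: the virtual profit of the grand bundle is positive at the
highest type, so selling it near the top beats selling nothing. -/
theorem exists_nonempty_mem (hn : (Finset.univ : Bundle n).Nonempty)
    (hβ : M.IsOptimalAssignment β) (hβB : ∀ t ∈ M.T, β t ∈ B) : ∃ c ∈ B, c.Nonempty := by
  by_contra! hB
  have hβ0 : ∀ t ∈ M.T, β t = ∅ := fun t ht => hB _ (hβB t ht)
  have hpos : M.virtualProfit ∅ M.tHi < M.virtualProfit Finset.univ M.tHi := by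
    have h1 := hM.efficient_top ∅ hn.ne_empty.symm
    rw [hM.v_empty _ hM.tHi_mem, hM.C_empty, sub_zero] at h1
    rw [hM.virtualProfit_empty hM.tHi_mem, virtualProfit, hM.cdf_tHi, sub_self, zero_mul, sub_zero]
    exact mul_pos h1 (hM.f_pos _ hM.tHi_mem)
  obtain ⟨x, hx1, hx2, hlt⟩ := hM.exists_left_lt hM.tHi_mem hM.tLo_lt_tHi hpos
  have hmono : MonotoneOn (fun t => if t < x then (∅ : Bundle n) else Finset.univ) M.T := by
    intro r _ t _ hrt
    simp only
    split_ifs with h1 h2 h2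
    · exact le_rfl
    · exact Finset.empty_subset _
    · exact absurd (hrt.trans_lt h2) h1
    · exact le_rfl
  have hmid : ∀ t ∈ M.T, x ≤ t → M.virtualProfit (β t) t <
      M.virtualProfit (if t < x then (∅ : Bundle n) else Finset.univ) t := by
    intro t ht h
    rw [hβ0 t ht, if_neg (not_lt.2 h)]
    exact hlt t ht h ht.2
  have hx : x ∈ M.T := ⟨hx1.le, hx2.le⟩
  refine hM.no_local_improvement hβ hmono (z := x) hx2 hx hM.tHi_mem
    (fun t ht => hmid t ⟨hx.1.trans ht.1.le, ht.2.le⟩ ht.1.le) fun t ht _ => ?_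
  rcases lt_or_ge t x with h | h
  · rw [hβ0 t ht, if_pos h]
  · exact (hmid t ht h).le

/-- The witness is the smallest non-empty bundle of B, which is sold at its stand-alone threshold; a
lower threshold of `b` would make the lottery profitable. -/
theorem exists_salesVolume_le (hnest : IsNested B) (hβ : M.IsOptimalAssignment β)
    (hβB : ∀ t ∈ M.T, β t ∈ B) (hentry : ∀ c ∈ B, c.Nonempty → ∃ τ w, M.IsEntry β c τ w)
    {b : Bundle n} (hb : b.Nonempty) :
    ∃ c ∈ B, c.Nonempty ∧ M.salesVolume b ≤ M.salesVolume c := by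
  obtain ⟨c₀, hc₀, hne₀⟩ := hM.exists_nonempty_mem (hb.mono (Finset.subset_univ b)) hβ hβB
  obtain ⟨c, ⟨hc, hne⟩, hmin⟩ := hnest.exists_least (S := {c | c ∈ B ∧ c.Nonempty})
    (fun c hc => hc.1) ⟨c₀, hc₀, hne₀⟩
  refine ⟨c, hc, hne, (hM.salesVolume_le_iff _ _).2 ?_⟩
  by_contra! hlt
  obtain ⟨τ, w, hτ⟩ := hentry c hc hne
  have hbelow : ∀ t ∈ M.T, t < τ → β t = ∅ := by
    intro t ht htτ
    by_contra hcon
    exact (hτ.below t ht htτ).2 (hmin _ ⟨hβB t ht, Finset.nonempty_iff_ne_empty.2 hcon⟩)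
  have heq := hM.threshold_eq_of_isEntry hβ hne hτ hbelow
  obtain ⟨a, p, hmech, himp⟩ := hM.exists_lottery_improvement hβ.monotoneOn hb hne hlt
    (heq ▸ hτ.lt.trans_le hτ.mem_right.2) (heq ▸ hbelow) (heq ▸ hτ.above)
  exact absurd (hβ.optimal a p hmech) (not_le.2 himp)

end Assumptions

end BundlingModel

end

theorem theorem2 {n : ℕ} (M : BundlingModel n) (hM : M.Assumptions)
    (B : Set (Bundle n)) (hB : IsMenu B) (hnest : IsNested B) :
    -- sufficiency
    (((∀ b₁ ∈ B, b₁.Nonempty → ∀ b₂ ∈ B, b₁ ⊂ b₂ → M.salesVolume b₂ < M.salesVolume b₁) ∧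
      (∀ b₁ ∉ B, ∃ b₂ ∈ B, b₁ ⊂ b₂ ∧ M.salesVolume b₁ ≤ M.salesVolume b₂)) →
        M.SellingOptimal B) ∧
    -- partial converse
    (M.MinimallyOptimal B →
      ((∀ b₁ ∈ B, b₁.Nonempty → ∀ b₂ ∈ B, b₁ ⊂ b₂ → M.salesVolume b₂ < M.salesVolume b₁) ∧
       (∀ b₁ ∉ B, ∃ b₂ ∈ B, b₂.Nonempty ∧ M.salesVolume b₁ ≤ M.salesVolume b₂))) := by
  refine ⟨fun h => hM.sellingOptimal_of_conditions hB hnest h.1 h.2, fun ⟨hsell, hmin⟩ => ?_⟩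
  obtain ⟨β, hmono, hβB, hopt⟩ := hM.exists_monotoneOn_of_sellingOptimal hnest hsell
  have hβ : M.IsOptimalAssignment β := ⟨hmono, hopt⟩
  have hentry : ∀ c ∈ B, c.Nonempty → ∃ τ w, M.IsEntry β c τ w := by
    intro c hc hne
    obtain ⟨s, hs, t, ht, hst, hsc, htc⟩ :=
      hM.exists_lt_of_minimallyOptimal hB hnest hmin hβ hβB hc hne
    obtain ⟨τ, hτ⟩ := BundlingModel.exists_isEntry hnest hmono hβB hc hs ht hst hsc htc
    exact ⟨τ, t, hτ⟩
  refine ⟨fun b₁ hb₁ hne b₂ hb₂ hss => (hM.salesVolume_lt_iff _ _).2 ?_, fun b₁ hb₁ => ?_⟩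
  · exact (hM.threshold_lt_of_ssubset hB hnest hβ hβB hentry _ b₂ hb₂ (hne.mono hss.1) rfl).2
      b₁ hb₁ hne hss
  · exact hM.exists_salesVolume_le hnest hβ hβB hentry
      (Finset.nonempty_iff_ne_empty.2 fun h => hb₁ (h ▸ hB))
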